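/- Setting. Let $\mathcal A$ be a finite set of nodes, node $\alpha$ having $n_\alpha$ poses $X_i^\alpha=[\,t_i^\alpha\ R_i^\alpha\,]\in\mathbb R^{d\times(d+1)}$. Write $X$ for the collection of all poses and $X^\alpha$ for those of node $\alpha$; $\|\cdot\|$ and $\langle\cdot,\cdot\rangle$ are the Frobenius norm and inner product. Let $\mathcal X$ be the set of $X$ with all $R_i^\alpha\in SO(d)$ (and $t_i^\alpha\in\mathbb R^d$ free), and $\mathcal X^\alpha$ its factor for node $\alpha$. Let $\overrightarrow{\mathcal E}$ be a finite set of directed edges $((\alpha,i),(\beta,j))$, each with weights $\kappa_{ij}^{\alpha\beta},\tau_{ij}^{\alpha\beta}\ge 0$ and a measurement $(\tilde t_{ij}^{\alpha\beta},\tilde R_{ij}^{\alpha\beta})\in\mathbb R^d\times SO(d)$. Put $$\|X\|^2_{M_{ij}^{\alpha\beta}}=\kappa_{ij}^{\alpha\beta}\|R_i^\alpha\tilde R_{ij}^{\alpha\beta}-R_j^\beta\|^2+\tau_{ij}^{\alpha\beta}\|R_i^\alpha\tilde t_{ij}^{\alpha\beta}+t_i^\alpha-t_j^\beta\|^2,$$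 $$\|X\|^2_{\Omega_{ij}^{\alpha\beta}}=2\big(\kappa_{ij}^{\alpha\beta}\|R_i^\alpha\|^2+\kappa_{ij}^{\alpha\beta}\|R_j^\beta\|^2+\tau_{ij}^{\alpha\beta}\|R_i^\alpha\tilde t_{ij}^{\alpha\beta}+t_i^\alpha\|^2+\tau_{ij}^{\alpha\beta}\|t_j^\beta\|^2\big).$$ The objective is $$F(X)=\sum_{\text{edges},\,\alpha=\beta}\tfrac12\|X\|^2_{M_{ij}^{\alpha\alpha}}+\sum_{\text{edges},\,\alpha\ne\beta}\tfrac12\rho\big(\|X\|^2_{M_{ij}^{\alpha\beta}}\big),$$ where the loss kernel $\rho:[0,\infty)\to\mathbb R$ is nonnegative and vanishes only at $0$, is $C^1$ and concave, satisfies $0\le\rho'\le1$ and $\rho'(0)=1$, and $X\mapsto\rho(\|X\|^2)$ has a Lipschitz continuous gradient on $\mathbb R^{d\times(d+1)}$. $\nabla F$ is the Euclidean gradient of $F$, and $\mathrm{grad}\,F(X)$ its orthogonal projection onto the tangent space of $\mathcal X$ at $X$ (the Riemannian gradient). Surrogates. Let $\zeta\ge\xi\ge0$. For the iterate $X^{(k)}$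 let $\omega_{ij}^{\alpha\beta(k)}=1$ if $\alpha=\beta$ and $\omega_{ij}^{\alpha\beta(k)}=\rho'\big(\|X^{(k)}\|^2_{M_{ij}^{\alpha\beta}}\big)$ if $\alpha\neq\beta$. Let $$\Gamma^{(k)}=\sum_{\alpha=\beta}M_{ij}^{\alpha\alpha}+\sum_{\alpha\ne\beta}\omega_{ij}^{\alpha\beta(k)}\Omega_{ij}^{\alpha\beta}+\xi I,\qquad \Pi^{(k)}=\sum_{\text{all edges}}\omega_{ij}^{\alpha\beta(k)}\Omega_{ij}^{\alpha\beta}+\zeta I,$$ with diagonal blocks $\Gamma^{\alpha(k)}$ and $\Pi^{\alpha(k)}$. For $Y=X^{(k)}$ or $Y=Y^{(k)}$ let $$G^\alpha(X^\alpha|Y)=\tfrac12\|X^\alpha-Y^\alpha\|^2_{\Gamma^{\alpha(k)}}+\langle\nabla_{X^\alpha}F(Y),X^\alpha-Y^\alpha\rangle,$$ $$H^\alpha(X^\alpha|Y)=\tfrac12\|X^\alpha-Y^\alpha\|^2_{\Pi^{\alpha(k)}}+\langle\nabla_{X^\alpha}F(Y),X^\alpha-Y^\alpha\rangle.$$ "$Z$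 improves $G(\cdot|Y)$ from $Z_0$" means $Z\in\mathcal X$ and $G^\alpha(Z^\alpha|Y)\le G^\alpha(Z_0^\alpha|Y)$ for every $\alpha$. "$Z$ minimizes $H(\cdot|Y)$" means that, for every $\alpha$, $Z^\alpha$ is a minimizer of $H^\alpha(\cdot|Y)$ over $\mathcal X^\alpha$. Method (AMM-PGO$^*$). Let $\eta,\phi\in(0,1]$, $\psi>0$, $X^{(-1)}=X^{(0)}\in\mathcal X$, $s^{\alpha(0)}=1$, $\overline F^{(-1)}=F(X^{(0)})$. Communication between neighbours and with the master node makes all the quantities below available. For $k=0,1,2,\dots$: 1. $s^{\alpha(k+1)}=\frac{\sqrt{4(s^{\alpha(k)})^2+1}+1}{2}$, $\lambda^{\alpha(k)}=\frac{s^{\alpha(k)}-1}{s^{\alpha(k+1)}}$, $Y^{\alpha(k)}=X^{\alpha(k)}+\lambda^{\alpha(k)}(X^{\alpha(k)}-X^{\alpha(k-1)})$, and $\overline F^{(k)}=(1-\eta)\overline F^{(k-1)}+\eta F(X^{(k)})$. 2. $X^{(k+\frac12)}$ minimizes $H(\cdot|Y^{(k)})$, and $X^{(k+1)}$ improves $G(\cdot|Y^{(k)})$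 from $X^{(k+\frac12)}$. 3. If $F(X^{(k+\frac12)})>\overline F^{(k)}-\psi\|X^{(k+\frac12)}-X^{(k)}\|^2$, replace $X^{(k+\frac12)}$ by a minimizer of $H(\cdot|X^{(k)})$. 4. If $F(X^{(k+1)})>\overline F^{(k)}-\psi\|X^{(k+1)}-X^{(k)}\|^2$, replace $X^{(k+1)}$ by a point that improves $G(\cdot|X^{(k)})$ from the current $X^{(k+\frac12)}$, and set $s^{\alpha(k)}\leftarrow\max\{\frac12s^{\alpha(k)},1\}$ for all $\alpha$ (after which $s^{\alpha(k+1)}$ may, or may not, be recomputed by the formula in step 1 from the new $s^{\alpha(k)}$; the result holds in both cases). 5. If $\overline F^{(k)}-F(X^{(k+1)})<\phi\,\big(\overline F^{(k)}-F(X^{(k+\frac12)})\big)$, set $X^{(k+1)}\leftarrow X^{(k+\frac12)}$. Proposition (convergence of AMM-PGO$^*$). For all sequences $\{X^{(k)}\}$, $\{X^{(k+\frac12)}\}$ generated by this method: (a) $\overline F^{(k)}$ is nonincreasing; (b) there is $F^\infty\in\mathbb R$ with $F(X^{(k)})\to F^\infty$ and $\overline F^{(k)}\to F^\infty$ as $k\to\infty$;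 (c) if $\xi>0$ and $\zeta>0$, then $\|X^{(k+1)}-X^{(k)}\|\to0$; (d) if $\zeta\ge\xi>0$, then $\|X^{(k+\frac12)}-X^{(k)}\|\to0$; (e) if $\zeta\ge\xi>0$, then there is $\epsilon>0$ such that for every integer $K\ge1$ $$\min_{0\le k<K}\|\mathrm{grad}\,F(X^{(k+\frac12)})\|\le2\sqrt{\frac1\epsilon\cdot\frac{F(X^{(0)})-F^\infty}{K+1}};$$ (f) if $\zeta>\xi>0$, then $\mathrm{grad}\,F(X^{(k)})\to0$ and $\mathrm{grad}\,F(X^{(k+\frac12)})\to0$. -/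

import Mathlib

open Filter Topology

noncomputable section

namespace PGO

/-- Loss kernels `ρ : [0, ∞) → ℝ`; only the values on `[0, ∞)` are constrained (and used), and the
derivative of `ρ` is the one relative to `[0, ∞)`, hence one-sided at `0`.  `m × n` is the size
of the matrices on which `X ↦ ρ (‖X‖²)` is required to have a Lipschitz gradient; matrices with
the Frobenius norm are `EuclideanSpace ℝ (Fin m × Fin n)`. -/
structure IsLossKernel (m n : ℕ) (ρ : ℝ → ℝ) : Prop where
  nonneg : ∀ s, 0 ≤ s → 0 ≤ ρ s
  eq_zero_iff : ∀ s, 0 ≤ s → (ρ s = 0 ↔ s = 0)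
  contDiffOn : ContDiffOn ℝ 1 ρ (Set.Ici 0)
  concaveOn : ConcaveOn ℝ (Set.Ici 0) ρ
  deriv_nonneg : ∀ s, 0 ≤ s → 0 ≤ derivWithin ρ (Set.Ici 0) s
  deriv_le_one : ∀ s, 0 ≤ s → derivWithin ρ (Set.Ici 0) s ≤ 1
  deriv_zero : derivWithin ρ (Set.Ici 0) 0 = 1
  lipschitz_gradient : ∃ μ : ℝ, 0 < μ ∧ ∀ X X' : EuclideanSpace ℝ (Fin m × Fin n),
    ‖gradient (fun Z : EuclideanSpace ℝ (Fin m × Fin n) => ρ (‖Z‖ ^ 2)) X -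
      gradient (fun Z : EuclideanSpace ℝ (Fin m × Fin n) => ρ (‖Z‖ ^ 2)) X'‖ ≤ μ * ‖X - X'‖

/-- The vertices `(α, i)`: the `i`-th pose of the node `α`. -/
abbrev Vertex {A : Type*} (n : A → ℕ) : Type _ := (α : A) × Fin (n α)

/-- The space of all `X`, one `d × (d+1)` block per pose, with the Frobenius norm.  The entry
`X (v, i, j)` is the entry `(i, j)` of the block of `v`. -/
abbrev Var {A : Type*} (n : A → ℕ) (d : ℕ) : Type _ :=
  EuclideanSpace ℝ (Vertex n × Fin d × Fin (d + 1))

/-- Squared Frobenius norm of a matrix. -/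
def matSq {d : ℕ} (M : Matrix (Fin d) (Fin d) ℝ) : ℝ := ∑ i, ∑ j, M i j ^ 2

/-- Squared Euclidean norm of a vector. -/
def vecSq {d : ℕ} (w : Fin d → ℝ) : ℝ := ∑ i, w i ^ 2

section Blocks

variable {A : Type*} {n : A → ℕ} {d : ℕ}

/-- The translation of a pose: the first column of its block `[t R]`. -/
def trans (X : Var n d) (v : Vertex n) : Fin d → ℝ := fun i => X (v, i, 0)

/-- The rotation of a pose: the last `d` columns of its block `[t R]`. -/
def rot (X : Var n d) (v : Vertex n) : Matrix (Fin d) (Fin d) ℝ :=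
  Matrix.of fun i j => X (v, i, j.succ)

/-- The feasible set: every rotation block lies in `SO(d)`, translations are free. -/
def feasible (n : A → ℕ) (d : ℕ) : Set (Var n d) :=
  {X | ∀ v, rot X v ∈ Matrix.specialOrthogonalGroup (Fin d) ℝ}

/-- The tangent space of the feasible set at `X`: directions whose rotation blocks `U` satisfy
`Rᵀ U + Uᵀ R = 0`, with arbitrary translation blocks. -/
def tangent [Fintype A] (X : Var n d) : Submodule ℝ (Var n d) where
  carrier := {U | ∀ v, (rot X v).transpose * rot U v + (rot U v).transpose * rot X v = 0}
  zero_mem' := by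
    intro v
    have h : rot (0 : Var n d) v = 0 := by ext i j; simp [rot]
    simp [h]
  add_mem' := by
    intro U W hU hW v
    have h : rot (U + W) v = rot U v + rot W v := by ext i j; simp [rot]
    have := congrArg₂ (· + ·) (hU v) (hW v)
    simp only [add_zero] at this
    rw [h, Matrix.transpose_add, Matrix.mul_add, Matrix.add_mul, ← this]
    abel
  smul_mem' := by
    intro c U hU v
    have h : rot (c • U) v = c • rot U v := by ext i j; simp [rot]
    rw [h, Matrix.transpose_smul, Matrix.mul_smul, Matrix.smul_mul, ← smul_add, hU v, smul_zero]

/-- The Riemannian gradient on the feasible set, a submanifold of Euclidean space with the induced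
metric: the orthogonal projection of the Euclidean gradient onto the tangent space. -/
def rgrad [Fintype A] (f : Var n d → ℝ) (X : Var n d) : Var n d :=
  (tangent X).starProjection (gradient f X)

/-- The part of `U` belonging to the node `α`, the blocks of all the other nodes being replaced
by zero. -/
def nodePart [DecidableEq A] (α : A) (U : Var n d) : Var n d :=
  WithLp.toLp 2 fun p => if p.1.1 = α then U p else 0

end Blocks

/-- The measurements of a distributed pose graph optimization problem with nodes `A`, where the
node `α` has `n α` poses: the directed edges, and for each edge the weights `κ`, `τ` and the
measured relative pose `(tm, Rm)` in `SE(d)`.  The data off the edges are never used. -/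
structure PoseGraph (A : Type*) (n : A → ℕ) (d : ℕ) where
  edges : Finset (Vertex n × Vertex n)
  κ : Vertex n × Vertex n → ℝ
  τ : Vertex n × Vertex n → ℝ
  tm : Vertex n × Vertex n → Fin d → ℝ
  Rm : Vertex n × Vertex n → Matrix (Fin d) (Fin d) ℝ
  κ_nonneg : ∀ e ∈ edges, 0 ≤ κ e
  τ_nonneg : ∀ e ∈ edges, 0 ≤ τ e
  Rm_mem : ∀ e ∈ edges, Rm e ∈ Matrix.specialOrthogonalGroup (Fin d) ℝ

namespace PoseGraph

variable {A : Type*} [DecidableEq A] {n : A → ℕ} {d : ℕ} (P : PoseGraph A n d)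

/-- `‖X‖²_M` for the edge `e = ((α, i), (β, j))`:
`κ ‖R_i R̃ - R_j‖² + τ ‖R_i t̃ + t_i - t_j‖²`. -/
def formM (e : Vertex n × Vertex n) (X : Var n d) : ℝ :=
  P.κ e * matSq (rot X e.1 * P.Rm e - rot X e.2) +
    P.τ e * vecSq ((rot X e.1).mulVec (P.tm e) + trans X e.1 - trans X e.2)

/-- `‖X‖²_Ω` for the edge `e = ((α, i), (β, j))`:
`2 (κ ‖R_i‖² + κ ‖R_j‖² + τ ‖R_i t̃ + t_i‖² + τ ‖t_j‖²)`. -/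
def formOmega (e : Vertex n × Vertex n) (X : Var n d) : ℝ :=
  2 * (P.κ e * matSq (rot X e.1) + P.κ e * matSq (rot X e.2) +
    P.τ e * vecSq ((rot X e.1).mulVec (P.tm e) + trans X e.1) + P.τ e * vecSq (trans X e.2))

/-- The objective function: quadratic for intra-node edges, robustified by `ρ` for inter-node
edges. -/
def F (ρ : ℝ → ℝ) (X : Var n d) : ℝ :=
  ∑ e ∈ P.edges, if e.1.1 = e.2.1 then (1 / 2) * P.formM e X else (1 / 2) * ρ (P.formM e X)

/-- The weight `ω` of an edge at `X`. -/
def omega (ρ : ℝ → ℝ) (X : Var n d) (e : Vertex n × Vertex n) : ℝ :=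
  if e.1.1 = e.2.1 then 1 else derivWithin ρ (Set.Ici 0) (P.formM e X)

variable [Fintype A]

/-- `‖U‖²_Γ`, where `Γ` is formed with the weights `ω` at `X`:
intra-node `M`, inter-node `ω Ω`, plus `ξ` times the identity. -/
def formGamma (ρ : ℝ → ℝ) (ξ : ℝ) (X U : Var n d) : ℝ :=
  (∑ e ∈ P.edges, if e.1.1 = e.2.1 then P.formM e U else P.omega ρ X e * P.formOmega e U) +
    ξ * ‖U‖ ^ 2

/-- `‖U‖²_Π`, where `Π` is formed with the weights `ω` at `X`:
`ω Ω` for all the edges, plus `ζ` times the identity. -/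
def formPi (ρ : ℝ → ℝ) (ζ : ℝ) (X U : Var n d) : ℝ :=
  (∑ e ∈ P.edges, P.omega ρ X e * P.formOmega e U) + ζ * ‖U‖ ^ 2

/-- The surrogate `G^α(Z^α | Y)` of the node `α`, expanded at `Y` with the weights `ω` at `X`:
`½ ‖Z^α - Y^α‖²_{Γ^α} + ⟨∇_α F(Y), Z^α - Y^α⟩`.  It depends on `Z` only through `Z^α`. -/
def G (ρ : ℝ → ℝ) (ξ : ℝ) (X Y : Var n d) (α : A) (Z : Var n d) : ℝ :=
  (1 / 2) * P.formGamma ρ ξ X (nodePart α (Z - Y)) +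
    inner ℝ (gradient (P.F ρ) Y) (nodePart α (Z - Y))

/-- The surrogate `H^α(Z^α | Y)` of the node `α`, expanded at `Y` with the weights `ω` at `X`:
`½ ‖Z^α - Y^α‖²_{Π^α} + ⟨∇_α F(Y), Z^α - Y^α⟩`.  It depends on `Z` only through `Z^α`. -/
def H (ρ : ℝ → ℝ) (ζ : ℝ) (X Y : Var n d) (α : A) (Z : Var n d) : ℝ :=
  (1 / 2) * P.formPi ρ ζ X (nodePart α (Z - Y)) +
    inner ℝ (gradient (P.F ρ) Y) (nodePart α (Z - Y))

/-- For every node `α`, the block `Z^α` minimizes `H^α(· | Y)` over the poses of `α`. -/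
def IsArgminH (ρ : ℝ → ℝ) (ζ : ℝ) (X Y Z : Var n d) : Prop :=
  Z ∈ feasible n d ∧ ∀ α, ∀ W ∈ feasible n d, P.H ρ ζ X Y α Z ≤ P.H ρ ζ X Y α W

/-- `Z` is feasible and, for every node `α`, improves (does not increase) `G^α(· | Y)` compared to
the initial guess `Z₀`. -/
def ImprovesG (ρ : ℝ → ℝ) (ξ : ℝ) (X Y Z₀ Z : Var n d) : Prop :=
  Z ∈ feasible n d ∧ ∀ α, P.G ρ ξ X Y α Z ≤ P.G ρ ξ X Y α Z₀

end PoseGraph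

/-- The parameters of the accelerated method. -/
structure Params where
  ξ : ℝ
  ζ : ℝ
  η : ℝ
  φ : ℝ
  ψ : ℝ
  ξ_nonneg : 0 ≤ ξ
  ξ_le_ζ : ξ ≤ ζ
  η_pos : 0 < η
  η_le_one : η ≤ 1
  φ_pos : 0 < φ
  φ_le_one : φ ≤ 1
  ψ_pos : 0 < ψ

/-- `s ↦ (√(4 s² + 1) + 1) / 2`. -/
def nesterov (s : ℝ) : ℝ := (Real.sqrt (4 * s ^ 2 + 1) + 1) / 2

/-- The extrapolated point `Y^α = X^α + λ^α (X^α - X_prev^α)` with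
`λ^α = (s^α - 1) / nesterov s^α`. -/
def extrapolate {A : Type*} {n : A → ℕ} {d : ℕ} (s : A → ℝ) (Xprev X : Var n d) : Var n d :=
  WithLp.toLp 2 fun p => X p + (s p.1.1 - 1) / nesterov (s p.1.1) * (X p - Xprev p)

namespace PoseGraph

variable {A : Type*} [DecidableEq A] {n : A → ℕ} {d : ℕ} (P : PoseGraph A n d)

/-- The averaged objective values `F̄^(k)` along a sequence, where `F̄^(-1) = F(X^(0))` and
`F̄^(k) = (1 - η) F̄^(k-1) + η F(X^(k))` for `k ≥ 0`. -/
def Fbar (ρ : ℝ → ℝ) (η : ℝ) (X : ℕ → Var n d) : ℕ → ℝ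
  | 0 => (1 - η) * P.F ρ (X 0) + η * P.F ρ (X 0)
  | k + 1 => (1 - η) * Fbar ρ η X k + η * P.F ρ (X (k + 1))

variable [Fintype A]

/-- The test that triggers a restart: no sufficient decrease from `X` to `Z` with respect to the
reference value `Fb`. -/
def NeedsRestart (ρ : ℝ → ℝ) (ψ Fb : ℝ) (X Z : Var n d) : Prop :=
  P.F ρ Z > Fb - ψ * ‖Z - X‖ ^ 2

/-- One iteration from `Xprev = X^(k-1)`, `X = X^(k)`, `Fb = F̄^(k)`, `s = s^(k)` to
`Xh = X^(k+1/2)`, `Xnext = X^(k+1)`, `snext = s^(k+1)`.  `Xh₁`, `X₁` are the candidates computed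
from the extrapolated point, `X₂` is the value of `X^(k+1)` after the second restart test. -/
structure IsIteration (ρ : ℝ → ℝ) (p : Params) (Xprev X : Var n d) (Fb : ℝ) (s : A → ℝ)
    (Xh₁ X₁ Xh X₂ Xnext : Var n d) (snext : A → ℝ) : Prop where
  half_candidate : P.IsArgminH ρ p.ζ X (extrapolate s Xprev X) Xh₁
  full_candidate : P.ImprovesG ρ p.ξ X (extrapolate s Xprev X) Xh₁ X₁
  half_restart : P.NeedsRestart ρ p.ψ Fb X Xh₁ → P.IsArgminH ρ p.ζ X X Xh
  half_keep : ¬ P.NeedsRestart ρ p.ψ Fb X Xh₁ → Xh = Xh₁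
  full_restart : P.NeedsRestart ρ p.ψ Fb X X₁ → P.ImprovesG ρ p.ξ X X Xh X₂
  full_keep : ¬ P.NeedsRestart ρ p.ψ Fb X X₁ → X₂ = X₁
  fallback : Fb - P.F ρ X₂ < p.φ * (Fb - P.F ρ Xh) → Xnext = Xh
  accept : ¬ (Fb - P.F ρ X₂ < p.φ * (Fb - P.F ρ Xh)) → Xnext = X₂
  /- A restart overwrites `s^(k)` by `max (s^(k) / 2) 1` after `s^(k+1)` was computed.  Both
  conventions are allowed: `s^(k+1)` keeps its value, or is recomputed from the new `s^(k)`. -/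
  momentum : ∀ α, snext α = nesterov (s α) ∨
    (P.NeedsRestart ρ p.ψ Fb X X₁ ∧ snext α = nesterov (max (s α / 2) 1))

/-- `X k = X^(k)` and `Xh k = X^(k+1/2)` are generated by the accelerated method with
master-based adaptive restart.  The truncated subtraction `0 - 1 = 0` encodes `X^(-1) = X^(0)`. -/
def IsRun (ρ : ℝ → ℝ) (p : Params) (X Xh : ℕ → Var n d) : Prop :=
  X 0 ∈ feasible n d ∧ ∃ s : ℕ → A → ℝ, (∀ α, s 0 α = 1) ∧
    ∀ k, ∃ Xh₁ X₁ X₂ : Var n d,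
      P.IsIteration ρ p (X (k - 1)) (X k) (P.Fbar ρ p.η X k) (s k) Xh₁ X₁ (Xh k) X₂ (X (k + 1))
        (s (k + 1))

end PoseGraph

end PGO

end

/-! Each edge has a linear residual `predict - actual`, and `F` is a sum of functions of squared
residual norms. Concavity puts `ρ` below its tangents, and `‖a - b‖² ≤ 2 (‖a‖² + ‖b‖²)` replaces
inter-node residuals by forms that decouple over the nodes. So the surrogates with weights and
expansion point at the current iterate majorize `F` (`F_le_majorant`).

The invariant is `F (X k) ≤ Fbar k`. Either a candidate passes the decrease test, or the half step
is redone at `X k`, where the majorant forces descent; the last test then transfers a fraction `φ`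
of the decrease to `X (k + 1)`. Hence `Fbar` is nonincreasing and bounded below by `0`. Its
decrement is `η (Fbar k - F (X (k + 1)))`, which controls the squared half displacement. A full step
started from `Xh k` need not decrease the surrogate at `X k`, because `Xh k` may come from the
extrapolated point. `ImprovesG.F_le` compares it with `F (Xh k)` instead, at the cost of a multiple
of `‖Xh k - X k‖²`, already controlled (`exists_displacement_le`).

Stationarity of the half step bounds its Riemannian gradient by its distance to the expansion point,
hence by two consecutive displacements. The squares are dominated by two-step decrements of `Fbar`;
telescoping gives the rate. Comparing tangent spaces at `X k` and `Xh k` carries the limit over to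
`X k`. -/

noncomputable section

namespace PGO

/-- `d × (d + 1)` matrices `[t R]` with the Frobenius norm. -/
abbrev Pose (d : ℕ) : Type := EuclideanSpace ℝ (Fin d × Fin (d + 1))

/-! ### Poses as Euclidean vectors -/

section Blocks

variable {A : Type*} {n : A → ℕ} {d : ℕ}

@[simp] lemma rot_add (X Y : Var n d) (v : Vertex n) : rot (X + Y) v = rot X v + rot Y v := by
  ext i j; simp [rot]

@[simp] lemma rot_sub (X Y : Var n d) (v : Vertex n) : rot (X - Y) v = rot X v - rot Y v := by
  ext i j; simp [rot]

@[simp] lemma rot_smul (c : ℝ) (X : Var n d) (v : Vertex n) : rot (c • X) v = c • rot X v := by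
  ext i j; simp [rot]

@[simp] lemma trans_add (X Y : Var n d) (v : Vertex n) :
    trans (X + Y) v = trans X v + trans Y v := by
  ext i; simp [trans]

@[simp] lemma trans_smul (c : ℝ) (X : Var n d) (v : Vertex n) :
    trans (c • X) v = c • trans X v := by
  ext i; simp [trans]

/-- The pose `[t R]` as a vector. -/
def mkPose (t : Fin d → ℝ) (R : Matrix (Fin d) (Fin d) ℝ) : Pose d :=
  WithLp.toLp 2 fun p => Fin.cases (t p.1) (fun j => R p.1 j) p.2

lemma mkPose_add (t t' : Fin d → ℝ) (R R' : Matrix (Fin d) (Fin d) ℝ) :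
    mkPose (t + t') (R + R') = mkPose t R + mkPose t' R' := by
  ext ⟨i, j⟩
  refine Fin.cases ?_ (fun j => ?_) j <;> simp [mkPose]

lemma mkPose_sub (t t' : Fin d → ℝ) (R R' : Matrix (Fin d) (Fin d) ℝ) :
    mkPose (t - t') (R - R') = mkPose t R - mkPose t' R' := by
  ext ⟨i, j⟩
  refine Fin.cases ?_ (fun j => ?_) j <;> simp [mkPose]

lemma mkPose_smul (c : ℝ) (t : Fin d → ℝ) (R : Matrix (Fin d) (Fin d) ℝ) :
    mkPose (c • t) (c • R) = c • mkPose t R := by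
  ext ⟨i, j⟩
  refine Fin.cases ?_ (fun j => ?_) j <;> simp [mkPose]

lemma norm_mkPose_sq (t : Fin d → ℝ) (R : Matrix (Fin d) (Fin d) ℝ) :
    ‖mkPose t R‖ ^ 2 = vecSq t + matSq R := by
  simp [EuclideanSpace.norm_sq_eq, Fintype.sum_prod_type, Fin.sum_univ_succ, mkPose, vecSq, matSq,
    Finset.sum_add_distrib]

lemma vecSq_smul (c : ℝ) (t : Fin d → ℝ) : vecSq (c • t) = c ^ 2 * vecSq t := by
  simp [vecSq, mul_pow, Finset.mul_sum]

lemma matSq_smul (c : ℝ) (R : Matrix (Fin d) (Fin d) ℝ) : matSq (c • R) = c ^ 2 * matSq R := by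
  simp [matSq, mul_pow, Finset.mul_sum]

lemma matSq_eq_trace (R : Matrix (Fin d) (Fin d) ℝ) : matSq R = (R * R.transpose).trace := by
  simp [matSq, Matrix.trace, Matrix.mul_apply, sq]

lemma matSq_mul_orthogonal (R Q : Matrix (Fin d) (Fin d) ℝ)
    (hQ : Q ∈ Matrix.specialOrthogonalGroup (Fin d) ℝ) : matSq (R * Q) = matSq R := by
  have h : Q * Q.transpose = 1 := by
    have := (Matrix.mem_orthogonalGroup_iff (Fin d) ℝ).1
      (Matrix.mem_specialOrthogonalGroup_iff.1 hQ).1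
    simpa [Matrix.star_eq_conjTranspose] using this
  rw [matSq_eq_trace, matSq_eq_trace, Matrix.transpose_mul, Matrix.mul_assoc,
    ← Matrix.mul_assoc Q, h, Matrix.one_mul]

end Blocks

/-! ### Edge forms as squared norms of linear maps, and their splitting over nodes -/

namespace PoseGraph

variable {A : Type*} {n : A → ℕ} {d : ℕ} (P : PoseGraph A n d) [Fintype A]

/-- The pose at the head of an edge as predicted from its tail, weighted. -/
def predict (e : Vertex n × Vertex n) : Var n d →L[ℝ] Pose d :=
  LinearMap.toContinuousLinearMap
    { toFun := fun X => mkPose (√(P.τ e) • ((rot X e.1).mulVec (P.tm e) + trans X e.1))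
        (√(P.κ e) • (rot X e.1 * P.Rm e))
      map_add' := fun X Y => by
        rw [← mkPose_add, ← smul_add, ← smul_add]
        simp only [rot_add, trans_add, Matrix.add_mulVec, Matrix.add_mul]
        congr 2; abel
      map_smul' := fun c X => by
        rw [RingHom.id_apply, ← mkPose_smul, smul_comm c, smul_comm c]
        simp only [rot_smul, trans_smul, Matrix.smul_mulVec, Matrix.smul_mul, smul_add] }

/-- The pose at the head of an edge, weighted. -/
def actual (e : Vertex n × Vertex n) : Var n d →L[ℝ] Pose d :=
  LinearMap.toContinuousLinearMap
    { toFun := fun X => mkPose (√(P.τ e) • trans X e.2) (√(P.κ e) • rot X e.2)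
      map_add' := fun X Y => by
        rw [← mkPose_add, ← smul_add, ← smul_add, rot_add, trans_add]
      map_smul' := fun c X => by
        rw [RingHom.id_apply, ← mkPose_smul, smul_comm c, smul_comm c, rot_smul, trans_smul] }

/-- The weighted residual of an edge. -/
def residual (e : Vertex n × Vertex n) : Var n d →L[ℝ] Pose d := P.predict e - P.actual e

lemma predict_apply (e : Vertex n × Vertex n) (X : Var n d) :
    P.predict e X = mkPose (√(P.τ e) • ((rot X e.1).mulVec (P.tm e) + trans X e.1))
        (√(P.κ e) • (rot X e.1 * P.Rm e)) := rfl

lemma actual_apply (e : Vertex n × Vertex n) (X : Var n d) :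
    P.actual e X = mkPose (√(P.τ e) • trans X e.2) (√(P.κ e) • rot X e.2) := rfl

lemma residual_apply (e : Vertex n × Vertex n) (X : Var n d) :
    P.residual e X = P.predict e X - P.actual e X := rfl

lemma formM_eq {e : Vertex n × Vertex n} (he : e ∈ P.edges) (X : Var n d) :
    P.formM e X = ‖P.residual e X‖ ^ 2 := by
  rw [residual_apply, predict_apply, actual_apply, ← mkPose_sub, ← smul_sub, ← smul_sub,
    norm_mkPose_sq, vecSq_smul, matSq_smul, Real.sq_sqrt (P.τ_nonneg e he),
    Real.sq_sqrt (P.κ_nonneg e he), formM, add_comm]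

/-- Right multiplication by the measured rotation preserves the Frobenius norm, which is why it
appears in `predict` but not in `formOmega`. -/
lemma formOmega_eq {e : Vertex n × Vertex n} (he : e ∈ P.edges) (X : Var n d) :
    P.formOmega e X = 2 * (‖P.predict e X‖ ^ 2 + ‖P.actual e X‖ ^ 2) := by
  rw [predict_apply, actual_apply, norm_mkPose_sq, norm_mkPose_sq, vecSq_smul, matSq_smul,
    vecSq_smul, matSq_smul, Real.sq_sqrt (P.τ_nonneg e he),
    Real.sq_sqrt (P.κ_nonneg e he), matSq_mul_orthogonal _ _ (P.Rm_mem e he), formOmega]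
  ring

lemma formM_le_formOmega {e : Vertex n × Vertex n} (he : e ∈ P.edges) (X : Var n d) :
    P.formM e X ≤ P.formOmega e X := by
  rw [formM_eq P he, formOmega_eq P he, residual_apply]
  have h := parallelogram_law_with_norm ℝ (P.predict e X) (P.actual e X)
  nlinarith [mul_self_nonneg ‖P.predict e X + P.actual e X‖]

lemma formM_nonneg {e : Vertex n × Vertex n} (he : e ∈ P.edges) (X : Var n d) :
    0 ≤ P.formM e X := by
  rw [formM_eq P he]; positivity

variable [DecidableEq A]

lemma predict_nodePart (e : Vertex n × Vertex n) (α : A) (U : Var n d) :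
    P.predict e (nodePart α U) = if e.1.1 = α then P.predict e U else 0 := by
  rw [predict_apply]
  split_ifs with h
  · have h1 : rot (nodePart α U) e.1 = rot U e.1 := by ext i j; simp [rot, nodePart, h]
    have h2 : trans (nodePart α U) e.1 = trans U e.1 := by ext i; simp [trans, nodePart, h]
    rw [h1, h2, predict_apply]
  · have h1 : rot (nodePart α U) e.1 = 0 := by ext i j; simp [rot, nodePart, h]
    have h2 : trans (nodePart α U) e.1 = 0 := by ext i; simp [trans, nodePart, h]
    have h3 := mkPose_smul 0 (0 : Fin d → ℝ) (0 : Matrix (Fin d) (Fin d) ℝ)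
    rw [smul_zero, smul_zero, zero_smul] at h3
    simp [h1, h2, h3]

lemma actual_nodePart (e : Vertex n × Vertex n) (α : A) (U : Var n d) :
    P.actual e (nodePart α U) = if e.2.1 = α then P.actual e U else 0 := by
  rw [actual_apply]
  split_ifs with h
  · have h1 : rot (nodePart α U) e.2 = rot U e.2 := by ext i j; simp [rot, nodePart, h]
    have h2 : trans (nodePart α U) e.2 = trans U e.2 := by ext i; simp [trans, nodePart, h]
    rw [h1, h2, actual_apply]
  · have h1 : rot (nodePart α U) e.2 = 0 := by ext i j; simp [rot, nodePart, h]
    have h2 : trans (nodePart α U) e.2 = 0 := by ext i; simp [trans, nodePart, h]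
    have h3 := mkPose_smul 0 (0 : Fin d → ℝ) (0 : Matrix (Fin d) (Fin d) ℝ)
    rw [smul_zero, smul_zero, zero_smul] at h3
    simp [h1, h2, h3]

/-- No cross term links the two ends of the edge, so the form is block diagonal over the nodes even
when the ends lie in different nodes. -/
lemma sum_formOmega_nodePart {e : Vertex n × Vertex n} (he : e ∈ P.edges) (U : Var n d) :
    ∑ α, P.formOmega e (nodePart α U) = P.formOmega e U := by
  have h (z : Pose d) (a α : A) : ‖if a = α then z else 0‖ ^ 2 = if a = α then ‖z‖ ^ 2 else 0 := by
    split_ifs <;> simp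
  simp only [formOmega_eq P he, predict_nodePart, actual_nodePart, h, ← Finset.mul_sum,
    Finset.sum_add_distrib]
  simp

lemma sum_formM_nodePart {e : Vertex n × Vertex n} (he : e ∈ P.edges) (h : e.1.1 = e.2.1)
    (U : Var n d) : ∑ α, P.formM e (nodePart α U) = P.formM e U := by
  have h' (α : A) : P.formM e (nodePart α U) = if e.1.1 = α then P.formM e U else 0 := by
    rw [formM_eq P he, formM_eq P he, residual_apply, predict_nodePart, actual_nodePart, ← h,
      residual_apply]
    split_ifs <;> simp
  simp [h']

end PoseGraph

lemma sum_nodePart {A : Type*} {n : A → ℕ} {d : ℕ} [Fintype A] [DecidableEq A] (U : Var n d) :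
    ∑ α, nodePart α U = U := by
  ext p
  simp [nodePart]

lemma sum_norm_nodePart_sq {A : Type*} {n : A → ℕ} {d : ℕ} [Fintype A] [DecidableEq A]
    (U : Var n d) : ∑ α, ‖nodePart α U‖ ^ 2 = ‖U‖ ^ 2 := by
  simp only [EuclideanSpace.norm_sq_eq]
  rw [Finset.sum_comm]
  refine Finset.sum_congr rfl fun p _ => ?_
  simp [nodePart, apply_ite]

namespace PoseGraph

variable {A : Type*} {n : A → ℕ} {d : ℕ} (P : PoseGraph A n d) [Fintype A] [DecidableEq A]

lemma sum_formGamma_nodePart (ρ : ℝ → ℝ) (ξ : ℝ) (X U : Var n d) :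
    ∑ α, P.formGamma ρ ξ X (nodePart α U) = P.formGamma ρ ξ X U := by
  simp only [formGamma, Finset.sum_add_distrib, ← Finset.mul_sum, sum_norm_nodePart_sq]
  rw [Finset.sum_comm]
  congr 1
  refine Finset.sum_congr rfl fun e he => ?_
  split_ifs with h
  · exact P.sum_formM_nodePart he h U
  · rw [← Finset.mul_sum, P.sum_formOmega_nodePart he]

lemma sum_formPi_nodePart (ρ : ℝ → ℝ) (ζ : ℝ) (X U : Var n d) :
    ∑ α, P.formPi ρ ζ X (nodePart α U) = P.formPi ρ ζ X U := by
  simp only [formPi, Finset.sum_add_distrib, ← Finset.mul_sum, sum_norm_nodePart_sq]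
  rw [Finset.sum_comm]
  congr 1
  refine Finset.sum_congr rfl fun e he => ?_
  rw [← Finset.mul_sum, P.sum_formOmega_nodePart he]

/-- Turns the nodewise inequalities of the method into one inequality for a quadratic model on the
whole space. -/
lemma sum_G (ρ : ℝ → ℝ) (ξ : ℝ) (X Y Z : Var n d) :
    ∑ α, P.G ρ ξ X Y α Z =
      1 / 2 * P.formGamma ρ ξ X (Z - Y) + inner ℝ (gradient (P.F ρ) Y) (Z - Y) := by
  simp only [G, Finset.sum_add_distrib, ← Finset.mul_sum, ← inner_sum, sum_formGamma_nodePart,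
    sum_nodePart]

lemma sum_H (ρ : ℝ → ℝ) (ζ : ℝ) (X Y Z : Var n d) :
    ∑ α, P.H ρ ζ X Y α Z =
      1 / 2 * P.formPi ρ ζ X (Z - Y) + inner ℝ (gradient (P.F ρ) Y) (Z - Y) := by
  simp only [H, Finset.sum_add_distrib, ← Finset.mul_sum, ← inner_sum, sum_formPi_nodePart,
    sum_nodePart]

end PoseGraph

/-! ### Loss kernels -/

namespace IsLossKernel

variable {m n : ℕ} {ρ : ℝ → ℝ} (hρ : IsLossKernel m n ρ)
include hρ

lemma hasDerivWithinAt {s : ℝ} (hs : 0 ≤ s) :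
    HasDerivWithinAt ρ (derivWithin ρ (Set.Ici 0) s) (Set.Ici 0) s :=
  ((hρ.contDiffOn.differentiableOn (by norm_num)) s hs).hasDerivWithinAt

lemma le_tangent {a b : ℝ} (ha : 0 ≤ a) (hb : 0 ≤ b) :
    ρ b ≤ ρ a + derivWithin ρ (Set.Ici 0) a * (b - a) := by
  rcases lt_trichotomy a b with h | rfl | h
  · have := hρ.concaveOn.slope_le_of_hasDerivWithinAt ha hb h (hρ.hasDerivWithinAt ha)
    rw [slope_def_field, div_le_iff₀ (sub_pos.2 h)] at this
    linarith
  · simp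
  · have := hρ.concaveOn.le_slope_of_hasDerivWithinAt hb ha h (hρ.hasDerivWithinAt ha)
    rw [slope_def_field, le_div_iff₀ (sub_pos.2 h)] at this
    linarith

/-- The one-sided derivative of `ρ` suffices, since `‖T Z‖ ^ 2` never leaves `[0, ∞)`. -/
lemma hasFDerivAt_comp_norm_sq {E G : Type*} [NormedAddCommGroup E] [InnerProductSpace ℝ E]
    [NormedAddCommGroup G] [InnerProductSpace ℝ G] (T : E →L[ℝ] G) (X : E) :
    HasFDerivAt (fun Z => ρ (‖T Z‖ ^ 2))
      (derivWithin ρ (Set.Ici 0) (‖T X‖ ^ 2) • (2 • (innerSL ℝ) (T X) ∘SL T)) X :=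
  (hρ.hasDerivWithinAt (sq_nonneg _)).comp_hasFDerivAt X T.hasFDerivAt.norm_sq
    (Eventually.of_forall fun _ => sq_nonneg _)

lemma gradient_norm_sq (Z : EuclideanSpace ℝ (Fin m × Fin n)) :
    gradient (fun Z : EuclideanSpace ℝ (Fin m × Fin n) => ρ (‖Z‖ ^ 2)) Z =
      (2 * derivWithin ρ (Set.Ici 0) (‖Z‖ ^ 2)) • Z := by
  apply HasGradientAt.gradient
  rw [hasGradientAt_iff_hasFDerivAt]
  refine (hρ.hasFDerivAt_comp_norm_sq (ContinuousLinearMap.id ℝ _) Z).congr_fderiv ?_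
  ext U
  simp [InnerProductSpace.toDual_apply_apply]
  ring

lemma exists_lipschitz : ∃ μ : ℝ, 0 ≤ μ ∧ ∀ Z Z' : EuclideanSpace ℝ (Fin m × Fin n),
    ‖derivWithin ρ (Set.Ici 0) (‖Z‖ ^ 2) • Z - derivWithin ρ (Set.Ici 0) (‖Z'‖ ^ 2) • Z'‖ ≤
      μ * ‖Z - Z'‖ := by
  obtain ⟨μ, hμ, h⟩ := hρ.lipschitz_gradient
  refine ⟨μ / 2, by positivity, fun Z Z' => ?_⟩
  have := h Z Z'
  rw [hρ.gradient_norm_sq, hρ.gradient_norm_sq, mul_smul, mul_smul, ← smul_sub, norm_smul] at this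
  norm_num at this
  linarith

end IsLossKernel

/-! ### Gradient of the objective and the majorant -/

namespace PoseGraph

variable {A : Type*} {n : A → ℕ} {d : ℕ} (P : PoseGraph A n d) [Fintype A] {ρ : ℝ → ℝ}

/-- A bound for `polarPi` that is uniform in the base point. -/
def boundPi (ζ : ℝ) : ℝ :=
  (∑ e ∈ P.edges, 2 * (‖P.predict e‖ ^ 2 + ‖P.actual e‖ ^ 2)) + ζ

lemma boundPi_nonneg {ζ : ℝ} (hζ : 0 ≤ ζ) : 0 ≤ P.boundPi ζ := by
  unfold boundPi; positivity

variable [DecidableEq A]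

lemma omega_nonneg (hρ : IsLossKernel d (d + 1) ρ) {e : Vertex n × Vertex n} (he : e ∈ P.edges)
    (X : Var n d) : 0 ≤ P.omega ρ X e := by
  unfold omega
  split_ifs
  · exact zero_le_one
  · exact hρ.deriv_nonneg _ (P.formM_nonneg he X)

lemma omega_le_one (hρ : IsLossKernel d (d + 1) ρ) {e : Vertex n × Vertex n} (he : e ∈ P.edges)
    (X : Var n d) : P.omega ρ X e ≤ 1 := by
  unfold omega
  split_ifs
  · exact le_rfl
  · exact hρ.deriv_le_one _ (P.formM_nonneg he X)

lemma F_nonneg (hρ : IsLossKernel d (d + 1) ρ) (X : Var n d) : 0 ≤ P.F ρ X := by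
  refine Finset.sum_nonneg fun e he => ?_
  have h := P.formM_nonneg he X
  split_ifs
  · positivity
  · have := hρ.nonneg _ h
    positivity

lemma hasGradientAt_F (hρ : IsLossKernel d (d + 1) ρ) (X : Var n d) :
    HasGradientAt (P.F ρ)
      (∑ e ∈ P.edges, (P.residual e).adjoint (P.omega ρ X e • P.residual e X)) X := by
  rw [hasGradientAt_iff_hasFDerivAt, map_sum]
  refine HasFDerivAt.fun_sum fun e he => ?_
  simp only [P.formM_eq he, omega]
  split_ifs with h
  · refine ((P.residual e).hasFDerivAt (x := X)).norm_sq.const_mul (1 / 2) |>.congr_fderiv ?_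
    ext U
    simp [InnerProductSpace.toDual_apply_apply, ContinuousLinearMap.adjoint_inner_left]
  · refine (hρ.hasFDerivAt_comp_norm_sq (P.residual e) X).const_mul (1 / 2) |>.congr_fderiv ?_
    ext U
    simp [InnerProductSpace.toDual_apply_apply, ContinuousLinearMap.adjoint_inner_left]
    ring

lemma gradient_F (hρ : IsLossKernel d (d + 1) ρ) (X : Var n d) :
    gradient (P.F ρ) X =
      ∑ e ∈ P.edges, (P.residual e).adjoint (P.omega ρ X e • P.residual e X) :=
  (P.hasGradientAt_F hρ X).gradient

lemma inner_gradient_F (hρ : IsLossKernel d (d + 1) ρ) (X U : Var n d) :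
    inner ℝ (gradient (P.F ρ) X) U =
      ∑ e ∈ P.edges, P.omega ρ X e * inner ℝ (P.residual e X) (P.residual e U) := by
  simp [P.gradient_F hρ, sum_inner, ContinuousLinearMap.adjoint_inner_left, inner_smul_left]

lemma exists_lipschitz_gradient_F (hρ : IsLossKernel d (d + 1) ρ) :
    ∃ L : ℝ, 0 < L ∧ ∀ X X' : Var n d,
      ‖gradient (P.F ρ) X - gradient (P.F ρ) X'‖ ≤ L * ‖X - X'‖ := by
  obtain ⟨μ, hμ, h⟩ := hρ.exists_lipschitz
  -- The factor `μ + 1` serves inter-node edges (constant `μ`) and intra-node ones (constant `1`)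
  -- alike; the last `+ 1` makes the constant positive.
  refine ⟨∑ e ∈ P.edges, ‖(P.residual e).adjoint‖ * ((μ + 1) * ‖P.residual e‖) + 1, by positivity,
    fun X X' => ?_⟩
  rw [P.gradient_F hρ, P.gradient_F hρ, ← Finset.sum_sub_distrib, add_mul, Finset.sum_mul]
  refine (norm_sum_le_of_le _ fun e he => ?_).trans (le_add_of_nonneg_right (by positivity))
  rw [← map_sub, mul_assoc]
  refine (ContinuousLinearMap.le_opNorm _ _).trans ?_
  refine mul_le_mul_of_nonneg_left ?_ (norm_nonneg _)
  have h1 : ‖P.omega ρ X e • P.residual e X - P.omega ρ X' e • P.residual e X'‖ ≤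
      (μ + 1) * ‖P.residual e X - P.residual e X'‖ := by
    unfold omega
    split_ifs
    · rw [one_smul, one_smul]
      nlinarith [norm_nonneg (P.residual e X - P.residual e X')]
    · rw [P.formM_eq he, P.formM_eq he]
      exact (h _ _).trans (mul_le_mul_of_nonneg_right (by linarith) (norm_nonneg _))
  refine h1.trans ?_
  rw [mul_assoc, ← map_sub]
  exact mul_le_mul_of_nonneg_left (ContinuousLinearMap.le_opNorm _ _) (by positivity)

lemma formGamma_eq (ρ : ℝ → ℝ) (ξ : ℝ) (X U : Var n d) :
    P.formGamma ρ ξ X U = (∑ e ∈ P.edges, P.omega ρ X e *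
      if e.1.1 = e.2.1 then P.formM e U else P.formOmega e U) + ξ * ‖U‖ ^ 2 := by
  unfold formGamma
  congr 1
  refine Finset.sum_congr rfl fun e he => ?_
  split_ifs with h
  · simp [omega, h]
  · rfl

/-- The surrogate with weights at `X` and expanded at `X` majorizes the objective. -/
lemma F_le_majorant (hρ : IsLossKernel d (d + 1) ρ) (ξ : ℝ) (X Z : Var n d) :
    P.F ρ Z ≤ P.F ρ X + inner ℝ (gradient (P.F ρ) X) (Z - X) +
      1 / 2 * P.formGamma ρ ξ X (Z - X) - ξ / 2 * ‖Z - X‖ ^ 2 := by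
  -- Edge by edge: an exact expansion on intra-node edges, and on the others the tangent bound for
  -- `ρ` followed by `M ≤ Ω`. The `ξ` term of `formGamma` is cancelled at the end.
  have key : ∀ e ∈ P.edges,
      (if e.1.1 = e.2.1 then (1 / 2) * P.formM e Z else (1 / 2) * ρ (P.formM e Z)) ≤
      (if e.1.1 = e.2.1 then (1 / 2) * P.formM e X else (1 / 2) * ρ (P.formM e X)) +
        P.omega ρ X e * inner ℝ (P.residual e X) (P.residual e (Z - X)) +
        1 / 2 * (P.omega ρ X e * if e.1.1 = e.2.1 then P.formM e (Z - X)
          else P.formOmega e (Z - X)) := by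
    intro e he
    have hq : P.formM e Z = P.formM e X + 2 * inner ℝ (P.residual e X) (P.residual e (Z - X)) +
        P.formM e (Z - X) := by
      rw [P.formM_eq he, P.formM_eq he, P.formM_eq he, ← norm_add_sq_real, ← map_add,
        add_sub_cancel]
    have hω := P.omega_nonneg hρ he X
    split_ifs with h
    · simp only [omega, if_pos h]
      linarith
    · have h1 := hρ.le_tangent (P.formM_nonneg he X) (P.formM_nonneg he Z)
      have h2 := mul_le_mul_of_nonneg_left (P.formM_le_formOmega he (Z - X)) hω
      simp only [omega, if_neg h] at h2 ⊢
      have h3 : derivWithin ρ (Set.Ici 0) (P.formM e X) * (P.formM e Z - P.formM e X) =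
        derivWithin ρ (Set.Ici 0) (P.formM e X) * (2 * inner ℝ (P.residual e X)
          (P.residual e (Z - X))) + derivWithin ρ (Set.Ici 0) (P.formM e X) * P.formM e (Z - X) := by
        rw [hq]; ring
      linarith
  have := Finset.sum_le_sum key
  rw [Finset.sum_add_distrib, Finset.sum_add_distrib, ← P.inner_gradient_F hρ,
    ← Finset.mul_sum] at this
  rw [P.formGamma_eq ρ]
  unfold F at this ⊢
  linarith

lemma formGamma_add_le_formPi (hρ : IsLossKernel d (d + 1) ρ) (ξ ζ : ℝ) (X U : Var n d) :
    P.formGamma ρ ξ X U + (ζ - ξ) * ‖U‖ ^ 2 ≤ P.formPi ρ ζ X U := by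
  have : ∑ e ∈ P.edges, P.omega ρ X e *
      (if e.1.1 = e.2.1 then P.formM e U else P.formOmega e U) ≤
      ∑ e ∈ P.edges, P.omega ρ X e * P.formOmega e U := by
    refine Finset.sum_le_sum fun e he => mul_le_mul_of_nonneg_left ?_ (P.omega_nonneg hρ he X)
    split_ifs
    · exact P.formM_le_formOmega he U
    · exact le_rfl
  rw [P.formGamma_eq ρ, formPi]
  linarith

/-- The symmetric bilinear form of the quadratic form `formPi`. -/
def polarPi (ρ : ℝ → ℝ) (ζ : ℝ) (X U V : Var n d) : ℝ :=
  (∑ e ∈ P.edges, P.omega ρ X e * (2 * (inner ℝ (P.predict e U) (P.predict e V) +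
    inner ℝ (P.actual e U) (P.actual e V)))) + ζ * inner ℝ U V

lemma formPi_eq_polarPi (ρ : ℝ → ℝ) (ζ : ℝ) (X U : Var n d) :
    P.formPi ρ ζ X U = P.polarPi ρ ζ X U U := by
  unfold formPi polarPi
  rw [real_inner_self_eq_norm_sq]
  congr 1
  refine Finset.sum_congr rfl fun e he => ?_
  rw [P.formOmega_eq he, real_inner_self_eq_norm_sq, real_inner_self_eq_norm_sq]

/-- Weights in `[0, 1]` make the bound independent of `X`. -/
lemma abs_polarPi_le (hρ : IsLossKernel d (d + 1) ρ) {ζ : ℝ} (hζ : 0 ≤ ζ) (X U V : Var n d) :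
    |P.polarPi ρ ζ X U V| ≤ P.boundPi ζ * (‖U‖ * ‖V‖) := by
  have hT (T : Var n d →L[ℝ] Pose d) : |inner ℝ (T U) (T V)| ≤ ‖T‖ ^ 2 * (‖U‖ * ‖V‖) :=
    calc |inner ℝ (T U) (T V)| ≤ ‖T U‖ * ‖T V‖ := abs_real_inner_le_norm _ _
      _ ≤ (‖T‖ * ‖U‖) * (‖T‖ * ‖V‖) := by gcongr <;> exact T.le_opNorm _
      _ = _ := by ring
  unfold polarPi boundPi
  rw [add_mul, Finset.sum_mul]
  refine (abs_add_le _ _).trans (add_le_add ((Finset.abs_sum_le_sum_abs _ _).trans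
    (Finset.sum_le_sum fun e he => ?_)) ?_)
  · rw [abs_mul, abs_of_nonneg (P.omega_nonneg hρ he X), abs_mul, abs_two]
    have h1 := abs_add_le (inner ℝ (P.predict e U) (P.predict e V))
      (inner ℝ (P.actual e U) (P.actual e V))
    have h2 := hT (P.predict e)
    have h3 := hT (P.actual e)
    calc _ ≤ 1 * (2 * |inner ℝ (P.predict e U) (P.predict e V) +
          inner ℝ (P.actual e U) (P.actual e V)|) := by
          gcongr; exact P.omega_le_one hρ he X
      _ ≤ _ := by linarith
  · rw [abs_mul, abs_of_nonneg hζ]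
    exact mul_le_mul_of_nonneg_left (abs_real_inner_le_norm _ _) hζ

lemma formPi_le (hρ : IsLossKernel d (d + 1) ρ) {ζ : ℝ} (hζ : 0 ≤ ζ) (X U : Var n d) :
    P.formPi ρ ζ X U ≤ P.boundPi ζ * ‖U‖ ^ 2 := by
  rw [formPi_eq_polarPi, sq]
  exact (le_abs_self _).trans (P.abs_polarPi_le hρ hζ X U U)

lemma hasDerivAt_formPi (ρ : ℝ → ℝ) (ζ : ℝ) (X : Var n d) {γ : ℝ → Var n d} {U : Var n d} {t : ℝ}
    (hγ : HasDerivAt γ U t) :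
    HasDerivAt (fun t => P.formPi ρ ζ X (γ t)) (2 * P.polarPi ρ ζ X (γ t) U) t := by
  have hT (T : Var n d →L[ℝ] Pose d) :
      HasDerivAt (fun t => ‖T (γ t)‖ ^ 2) (2 * inner ℝ (T (γ t)) (T U)) t :=
    (T.hasFDerivAt.comp_hasDerivAt t hγ).norm_sq
  unfold formPi polarPi
  rw [mul_add, Finset.mul_sum]
  refine HasDerivAt.add (HasDerivAt.fun_sum fun e he => ?_) ?_
  · simp only [P.formOmega_eq he]
    refine (((hT (P.predict e)).add (hT (P.actual e))).const_mul 2).const_mul (P.omega ρ X e)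
      |>.congr_deriv ?_
    ring
  · refine hγ.norm_sq.const_mul ζ |>.congr_deriv ?_
    ring

end PoseGraph

/-! ### Functions with Lipschitz gradient -/

section Descent

variable {E : Type*} [NormedAddCommGroup E] [InnerProductSpace ℝ E] [CompleteSpace E]

lemma abs_sub_sub_inner_gradient_le {f : E → ℝ} {L : ℝ} (hf : Differentiable ℝ f)
    (hL : ∀ x y, ‖gradient f x - gradient f y‖ ≤ L * ‖x - y‖) (hL0 : 0 ≤ L) (x y : E) :
    |f y - f x - inner ℝ (gradient f x) (y - x)| ≤ L * ‖y - x‖ ^ 2 := by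
  have := Convex.norm_image_sub_le_of_norm_hasFDerivWithin_le' (𝕜 := ℝ) (f := f)
    (f' := fun z => InnerProductSpace.toDual ℝ E (gradient f z)) (s := segment ℝ x y)
    (φ := InnerProductSpace.toDual ℝ E (gradient f x)) (C := L * ‖y - x‖) (x := x) (y := y)
    (fun z _ => ((hf z).hasGradientAt.hasFDerivAt).hasFDerivWithinAt)
    (fun z hz => by
      rw [← map_sub, LinearIsometryEquiv.norm_map]
      exact (hL z x).trans (mul_le_mul_of_nonneg_left (norm_sub_le_of_mem_segment hz) hL0))
    (convex_segment x y) (left_mem_segment ℝ x y) (right_mem_segment ℝ x y)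
  rw [InnerProductSpace.toDual_apply_apply, Real.norm_eq_abs] at this
  linarith

/-- A gradient step of length `1 / (2 * L)` lowers `f` by at least `‖gradient f x‖ ^ 2 / (4 * L)`,
yet cannot reach below `0`. -/
lemma norm_gradient_sq_le {f : E → ℝ} {L : ℝ} (hf : Differentiable ℝ f)
    (hL : ∀ x y, ‖gradient f x - gradient f y‖ ≤ L * ‖x - y‖) (hL0 : 0 < L) (h0 : ∀ x, 0 ≤ f x)
    (x : E) : ‖gradient f x‖ ^ 2 ≤ 4 * L * f x := by
  have h := abs_sub_sub_inner_gradient_le hf hL hL0.le x (x - (1 / (2 * L)) • gradient f x)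
  rw [sub_sub_cancel_left, inner_neg_right, inner_smul_right, real_inner_self_eq_norm_sq, norm_neg,
    norm_smul, mul_pow, Real.norm_eq_abs, sq_abs] at h
  have h1 := (abs_le.1 h).2
  have h2 := h0 (x - (1 / (2 * L)) • gradient f x)
  have h3 : L * ((1 / (2 * L)) ^ 2 * ‖gradient f x‖ ^ 2) = ‖gradient f x‖ ^ 2 / (4 * L) := by
    field_simp; ring
  have h4 : 1 / (2 * L) * ‖gradient f x‖ ^ 2 = 2 * (‖gradient f x‖ ^ 2 / (4 * L)) := by
    field_simp; ring
  have h5 : ‖gradient f x‖ ^ 2 / (4 * L) ≤ f x := by linarith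
  rw [div_le_iff₀ (by positivity)] at h5
  linarith

end Descent

/-! ### Tangent spaces and Riemannian gradients on the feasible set -/

section Manifold

variable {d : ℕ}

lemma transpose_mul_self_of_mem {R : Matrix (Fin d) (Fin d) ℝ}
    (hR : R ∈ Matrix.specialOrthogonalGroup (Fin d) ℝ) : R.transpose * R = 1 := by
  have := (Matrix.mem_orthogonalGroup_iff' (Fin d) ℝ).1
    (Matrix.mem_specialOrthogonalGroup_iff.1 hR).1
  simpa [Matrix.star_eq_conjTranspose] using this

lemma mul_transpose_self_of_mem {R : Matrix (Fin d) (Fin d) ℝ}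
    (hR : R ∈ Matrix.specialOrthogonalGroup (Fin d) ℝ) : R * R.transpose = 1 :=
  mul_eq_one_comm.1 (transpose_mul_self_of_mem hR)

open scoped Matrix.Norms.Operator in
lemma exp_mem_specialOrthogonalGroup {S : Matrix (Fin d) (Fin d) ℝ} (hS : S.transpose = -S) :
    NormedSpace.exp S ∈ Matrix.specialOrthogonalGroup (Fin d) ℝ := by
  have orth (T : Matrix (Fin d) (Fin d) ℝ) (hT : T.transpose = -T) :
      NormedSpace.exp T * (NormedSpace.exp T).transpose = 1 := by
    rw [← Matrix.exp_transpose, hT,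
      ← Matrix.exp_add_of_commute _ _ (Commute.neg_right (Commute.refl T)), add_neg_cancel,
      NormedSpace.exp_zero]
  rw [Matrix.mem_specialOrthogonalGroup_iff, Matrix.mem_orthogonalGroup_iff]
  refine ⟨by simpa [Matrix.star_eq_conjTranspose] using orth S hS, ?_⟩
  -- Orthogonality only gives determinant `±1`; the sign is settled by `exp S = exp (S / 2) ^ 2`,
  -- whose determinant is that of `exp (S / 2)` times its transpose.
  have hhalf : ((1 / 2 : ℝ) • S).transpose = -((1 / 2 : ℝ) • S) := by
    rw [Matrix.transpose_smul, hS, smul_neg]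
  have h := congrArg Matrix.det (orth _ hhalf)
  rw [Matrix.det_mul, Matrix.det_transpose, Matrix.det_one, ← Matrix.det_mul,
    ← Matrix.exp_add_of_commute _ _ (Commute.refl _), ← add_smul] at h
  norm_num at h
  exact h

open scoped Matrix.Norms.Operator in
lemma hasDerivAt_mul_exp_smul_apply (R S : Matrix (Fin d) (Fin d) ℝ) (i j : Fin d) :
    HasDerivAt (fun t : ℝ => (R * NormedSpace.exp (t • S)) i j) ((R * S) i j) 0 := by
  have h := (hasDerivAt_exp_smul_const S (0 : ℝ)).const_mul R
  rw [zero_smul, NormedSpace.exp_zero, one_mul] at h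
  exact hasDerivAt_pi.1 (hasDerivAt_pi.1 h i) j

variable {A : Type*} {n : A → ℕ}

/-- Replace the rotation blocks of `U` by the matrices `M v`. -/
def withRot (U : Var n d) (M : Vertex n → Matrix (Fin d) (Fin d) ℝ) : Var n d :=
  WithLp.toLp 2 fun p => Fin.cases (U p) (fun j => M p.1 p.2.1 j) p.2.2

lemma rot_withRot (U : Var n d) (M : Vertex n → Matrix (Fin d) (Fin d) ℝ) (v : Vertex n) :
    rot (withRot U M) v = M v := by
  ext i j; simp [rot, withRot]

lemma withRot_rot (U : Var n d) : withRot U (rot U) = U := by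
  ext ⟨v, i, j⟩
  refine Fin.cases ?_ (fun j => ?_) j <;> simp [rot, withRot]

variable [Fintype A]

lemma mem_tangent {X U : Var n d} : U ∈ tangent X ↔
    ∀ v, (rot X v).transpose * rot U v + (rot U v).transpose * rot X v = 0 := Iff.rfl

/-- Every tangent vector is the velocity of a feasible curve. -/
lemma exists_feasible_curve {X U : Var n d} (hX : X ∈ feasible n d) (hU : U ∈ tangent X) :
    ∃ γ : ℝ → Var n d, γ 0 = X ∧ (∀ t, γ t ∈ feasible n d) ∧ HasDerivAt γ U 0 := by
  -- Tangency says that `S v` is skew. The curve is `R exp (t S)` on rotations and a straight line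
  -- on translations.
  set S : Vertex n → Matrix (Fin d) (Fin d) ℝ := fun v => (rot X v).transpose * rot U v with hS
  have hskew (v : Vertex n) : (S v).transpose = -S v := by
    have := mem_tangent.1 hU v
    rw [hS, Matrix.transpose_mul, Matrix.transpose_transpose]
    exact (neg_eq_of_add_eq_zero_right this).symm
  have hRS (v : Vertex n) : rot X v * S v = rot U v := by
    rw [hS, ← Matrix.mul_assoc, mul_transpose_self_of_mem (hX v), Matrix.one_mul]
  refine ⟨fun t => withRot (X + t • U) fun v => rot X v * NormedSpace.exp (t • S v), ?_, ?_, ?_⟩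
  · simp only [zero_smul, add_zero, NormedSpace.exp_zero, Matrix.mul_one]
    exact withRot_rot X
  · intro t v
    rw [rot_withRot]
    refine mul_mem (hX v) (exp_mem_specialOrthogonalGroup ?_)
    rw [Matrix.transpose_smul, hskew, smul_neg]
  · refine (PiLp.hasFDerivAt_toLp (𝕜 := ℝ) (E := fun _ => ℝ) 2 _).comp_hasDerivAt (0 : ℝ)
      (hasDerivAt_pi (φ' := fun p => U p).2 ?_)
    rintro ⟨v, i, j⟩
    refine Fin.cases ?_ (fun j => ?_) j
    · simpa using ((hasDerivAt_id (0 : ℝ)).mul_const (U (v, i, 0))).const_add (X (v, i, 0))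
    · refine (hasDerivAt_mul_exp_smul_apply (rot X v) (S v) i j).congr_deriv ?_
      rw [hRS]; rfl

lemma abs_apply_le_norm (U : Var n d) (p : Vertex n × Fin d × Fin (d + 1)) : |U p| ≤ ‖U‖ := by
  simpa using PiLp.norm_apply_le U p

lemma norm_le_of_forall_abs_le {U : Var n d} {b : ℝ} (h : ∀ p, |U p| ≤ b) :
    ‖U‖ ≤ Fintype.card (Vertex n × Fin d × Fin (d + 1)) * b := by
  have h1 : ‖U‖ ≤ ∑ p, |U p| := by
    rw [EuclideanSpace.norm_eq]
    refine Real.sqrt_le_iff.2 ⟨Finset.sum_nonneg fun _ _ => abs_nonneg _, ?_⟩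
    exact Finset.sum_sq_le_sq_sum_of_nonneg fun p _ => norm_nonneg (U p)
  refine h1.trans ((Finset.sum_le_sum fun p _ => h p).trans ?_)
  rw [Finset.sum_const, nsmul_eq_mul, Finset.card_univ]

lemma abs_apply_le_one_of_mem {R : Matrix (Fin d) (Fin d) ℝ}
    (hR : R ∈ Matrix.specialOrthogonalGroup (Fin d) ℝ) (i j : Fin d) : |R i j| ≤ 1 := by
  have h := congrFun (congrFun (mul_transpose_self_of_mem hR) i) i
  rw [Matrix.mul_apply, Matrix.one_apply_eq] at h
  refine (abs_le_one_iff_mul_self_le_one).2 ?_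
  rw [← h]
  exact Finset.single_le_sum (f := fun k => R i k * R.transpose k i)
    (fun k _ => mul_self_nonneg (R i k)) (Finset.mem_univ j)

/-- A constant for the dependence of the tangent spaces on the base point. -/
def transportConst (n : A → ℕ) (d : ℕ) : ℝ :=
  Fintype.card (Vertex n × Fin d × Fin (d + 1)) * ((d : ℝ) * d)

/-- Left translation by `R_Z R_Xᵀ` carries tangent vectors at `X` to tangent vectors at `Z`; as `R_X
R_Xᵀ = 1`, it moves the rotation block `U` by `(R_Z - R_X) R_Xᵀ U`. -/
lemma exists_transport {X Z U : Var n d} (hX : X ∈ feasible n d) (hZ : Z ∈ feasible n d)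
    (hU : U ∈ tangent X) :
    ∃ V ∈ tangent Z, ‖V - U‖ ≤ transportConst n d * (‖Z - X‖ * ‖U‖) := by
  refine ⟨withRot U fun v => rot Z v * ((rot X v).transpose * rot U v), ?_, ?_⟩
  · rw [mem_tangent]
    intro v
    rw [rot_withRot, ← Matrix.mul_assoc, transpose_mul_self_of_mem (hZ v), Matrix.one_mul,
      Matrix.transpose_mul, Matrix.mul_assoc, transpose_mul_self_of_mem (hZ v), Matrix.mul_one,
      Matrix.transpose_mul, Matrix.transpose_transpose]
    exact mem_tangent.1 hU v
  · rw [transportConst, mul_assoc]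
    refine norm_le_of_forall_abs_le ?_
    rintro ⟨v, i, j⟩
    refine Fin.cases ?_ (fun j => ?_) j
    · simp [withRot]
      positivity
    · have h1 : (withRot U (fun v => rot Z v * ((rot X v).transpose * rot U v)) - U) (v, i, j.succ)
          = (rot (Z - X) v * ((rot X v).transpose * rot U v)) i j := by
        rw [rot_sub, Matrix.sub_mul, ← Matrix.mul_assoc (rot X v),
          mul_transpose_self_of_mem (hX v), Matrix.one_mul]
        rfl
      rw [h1, Matrix.mul_apply]
      have h2 (k : Fin d) : |((rot X v).transpose * rot U v) k j| ≤ d * ‖U‖ := by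
        rw [Matrix.mul_apply]
        refine (Finset.abs_sum_le_sum_abs _ _).trans ?_
        refine (Finset.sum_le_sum (g := fun _ => ‖U‖) fun l _ => ?_).trans (by simp)
        rw [abs_mul, Matrix.transpose_apply]
        calc _ ≤ 1 * ‖U‖ := mul_le_mul (abs_apply_le_one_of_mem (hX v) l k)
              (abs_apply_le_norm U _) (abs_nonneg _) zero_le_one
          _ = ‖U‖ := one_mul _
      refine (Finset.abs_sum_le_sum_abs _ _).trans ?_
      refine (Finset.sum_le_sum (g := fun _ => ‖Z - X‖ * (d * ‖U‖)) fun k _ => ?_).trans ?_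
      · rw [abs_mul]
        exact mul_le_mul (abs_apply_le_norm (Z - X) _) (h2 k) (abs_nonneg _) (norm_nonneg _)
      · rw [Finset.sum_const, nsmul_eq_mul, Finset.card_univ, Fintype.card_fin]
        exact le_of_eq (by ring)

lemma rgrad_mem_tangent (f : Var n d → ℝ) (X : Var n d) : rgrad f X ∈ tangent X :=
  Submodule.starProjection_apply_mem _ _

lemma inner_rgrad {f : Var n d → ℝ} {X U : Var n d} (hU : U ∈ tangent X) :
    inner ℝ (rgrad f X) U = inner ℝ (gradient f X) U := by
  rw [rgrad, Submodule.inner_starProjection_left_eq_right,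
    Submodule.starProjection_eq_self_iff.2 hU]

lemma norm_rgrad_le_norm_gradient (f : Var n d → ℝ) (X : Var n d) :
    ‖rgrad f X‖ ≤ ‖gradient f X‖ :=
  Submodule.norm_starProjection_apply_le _ _

/-- Test with `U = rgrad f X`. -/
lemma norm_rgrad_le_of_forall_inner_le {f : Var n d → ℝ} {X : Var n d} {b : ℝ} (hb : 0 ≤ b)
    (h : ∀ U ∈ tangent X, inner ℝ (gradient f X) U ≤ b * ‖U‖) : ‖rgrad f X‖ ≤ b := by
  have h1 := h _ (rgrad_mem_tangent f X)
  rw [← inner_rgrad (rgrad_mem_tangent f X), real_inner_self_eq_norm_sq, sq] at h1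
  rcases (norm_nonneg (rgrad f X)).eq_or_lt with h0 | h0
  · rwa [← h0]
  · exact le_of_mul_le_mul_right h1 h0

/-- The norm of the Riemannian gradient varies continuously along the feasible set. -/
lemma norm_rgrad_le_add {f : Var n d → ℝ} {L : ℝ} (hL0 : 0 ≤ L)
    (hL : ∀ x y, ‖gradient f x - gradient f y‖ ≤ L * ‖x - y‖) {X Z : Var n d}
    (hX : X ∈ feasible n d) (hZ : Z ∈ feasible n d) :
    ‖rgrad f X‖ ≤ ‖rgrad f Z‖ +
      (L + 2 * ‖gradient f Z‖ * transportConst n d) * ‖Z - X‖ := by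
  have hc : 0 ≤ transportConst n d := by unfold transportConst; positivity
  refine norm_rgrad_le_of_forall_inner_le (by positivity) fun U hU => ?_
  obtain ⟨V, hV, hVU⟩ := exists_transport hX hZ hU
  -- At `Z` the gradient and its projection agree only against the transported vector `V`;
  -- exchanging them against `U` leaves two errors in `V - U`, hence the factor `2` in the
  -- statement.
  have e : inner ℝ (gradient f X) U = inner ℝ (gradient f X - gradient f Z) U -
      inner ℝ (gradient f Z) (V - U) + inner ℝ (rgrad f Z) (V - U) + inner ℝ (rgrad f Z) U := by
    have := inner_rgrad (f := f) hV
    simp only [inner_sub_left, inner_sub_right]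
    linarith
  have h1 : inner ℝ (gradient f X - gradient f Z) U ≤ L * ‖Z - X‖ * ‖U‖ := by
    rw [norm_sub_rev Z X]
    exact (real_inner_le_norm _ _).trans (mul_le_mul_of_nonneg_right (hL X Z) (norm_nonneg _))
  have h2 : -inner ℝ (gradient f Z) (V - U) ≤
      ‖gradient f Z‖ * (transportConst n d * (‖Z - X‖ * ‖U‖)) :=
    (neg_le_abs _).trans ((abs_real_inner_le_norm _ _).trans
      (mul_le_mul_of_nonneg_left hVU (norm_nonneg _)))
  have h3 : inner ℝ (rgrad f Z) (V - U) ≤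
      ‖gradient f Z‖ * (transportConst n d * (‖Z - X‖ * ‖U‖)) :=
    (real_inner_le_norm _ _).trans
      (mul_le_mul (norm_rgrad_le_norm_gradient f Z) hVU (norm_nonneg _) (norm_nonneg _))
  have h4 := real_inner_le_norm (rgrad f Z) U
  rw [e]
  nlinarith

end Manifold

/-! ### Extrapolation -/

lemma one_le_nesterov (s : ℝ) : 1 ≤ nesterov s := by
  have : (1 : ℝ) ≤ √(4 * s ^ 2 + 1) := Real.one_le_sqrt.2 (by nlinarith [sq_nonneg s])
  unfold nesterov; linarith

lemma le_nesterov (s : ℝ) : s ≤ nesterov s := by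
  have : 2 * s ≤ √(4 * s ^ 2 + 1) := Real.le_sqrt_of_sq_le (by nlinarith)
  unfold nesterov; linarith

/-- Every momentum coefficient lies in `[0, 1]`, because `1 ≤ s ≤ nesterov s`. -/
lemma norm_extrapolate_sub_le {A : Type*} {n : A → ℕ} {d : ℕ} [Fintype A] {s : A → ℝ}
    (hs : ∀ α, 1 ≤ s α) (Xprev X : Var n d) :
    ‖extrapolate s Xprev X - X‖ ≤ ‖X - Xprev‖ := by
  rw [EuclideanSpace.norm_eq, EuclideanSpace.norm_eq]
  refine Real.sqrt_le_sqrt (Finset.sum_le_sum fun p _ => ?_)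
  have h1 : 0 ≤ (s p.1.1 - 1) / nesterov (s p.1.1) :=
    div_nonneg (by linarith [hs p.1.1]) (by linarith [one_le_nesterov (s p.1.1)])
  have h2 : (s p.1.1 - 1) / nesterov (s p.1.1) ≤ 1 :=
    (div_le_one (by linarith [one_le_nesterov (s p.1.1)])).2 (by linarith [le_nesterov (s p.1.1)])
  have h3 : (extrapolate s Xprev X - X) p =
      (s p.1.1 - 1) / nesterov (s p.1.1) * (X - Xprev) p := by
    simp [extrapolate]
  rw [h3, norm_mul, Real.norm_of_nonneg h1]
  gcongr
  exact mul_le_of_le_one_left (norm_nonneg _) h2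

/-! ### One iteration -/

namespace PoseGraph

variable {A : Type*} {n : A → ℕ} {d : ℕ} {P : PoseGraph A n d} [Fintype A] [DecidableEq A]
  {ρ : ℝ → ℝ}

lemma IsArgminH.sum_le {ζ : ℝ} {X Y Z W : Var n d} (h : P.IsArgminH ρ ζ X Y Z)
    (hW : W ∈ feasible n d) :
    1 / 2 * P.formPi ρ ζ X (Z - Y) + inner ℝ (gradient (P.F ρ) Y) (Z - Y) ≤
      1 / 2 * P.formPi ρ ζ X (W - Y) + inner ℝ (gradient (P.F ρ) Y) (W - Y) := by
  rw [← P.sum_H, ← P.sum_H]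
  exact Finset.sum_le_sum fun α _ => h.2 α W hW

lemma ImprovesG.sum_le {ξ : ℝ} {X Y Z₀ Z : Var n d} (h : P.ImprovesG ρ ξ X Y Z₀ Z) :
    1 / 2 * P.formGamma ρ ξ X (Z - Y) + inner ℝ (gradient (P.F ρ) Y) (Z - Y) ≤
      1 / 2 * P.formGamma ρ ξ X (Z₀ - Y) + inner ℝ (gradient (P.F ρ) Y) (Z₀ - Y) := by
  rw [← P.sum_G, ← P.sum_G]
  exact Finset.sum_le_sum fun α _ => h.2 α

/-- The first order optimality condition for the minimization of the surrogate. -/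
lemma IsArgminH.inner_eq_zero {ζ : ℝ} {X Y Z U : Var n d} (h : P.IsArgminH ρ ζ X Y Z)
    (hU : U ∈ tangent Z) :
    P.polarPi ρ ζ X (Z - Y) U + inner ℝ (gradient (P.F ρ) Y) U = 0 := by
  obtain ⟨γ, h0, hγ, hγ'⟩ := exists_feasible_curve h.1 hU
  have hd := ((P.hasDerivAt_formPi ρ ζ X (hγ'.sub_const Y)).const_mul (1 / 2)).add
    ((innerSL ℝ (gradient (P.F ρ) Y)).hasFDerivAt.comp_hasDerivAt (0 : ℝ) (hγ'.sub_const Y))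
  have hm : IsLocalMin ((fun t => 1 / 2 * P.formPi ρ ζ X (γ t - Y)) +
      (innerSL ℝ (gradient (P.F ρ) Y)) ∘ fun t => γ t - Y) 0 :=
    Eventually.of_forall fun t => by
      simpa [h0] using h.sum_le (hγ t)
  have := hm.hasDerivAt_eq_zero hd
  rw [h0] at this
  simpa using this

/-- On tangent vectors at `Z`, stationarity turns `∇F(Y)` into `-polarPi (Z - Y)`; passing from
`∇F(Y)` to `∇F(Z)` costs `L * ‖Z - Y‖`. -/
lemma IsArgminH.norm_rgrad_le (hρ : IsLossKernel d (d + 1) ρ) {L : ℝ}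
    (hL : ∀ x y, ‖gradient (P.F ρ) x - gradient (P.F ρ) y‖ ≤ L * ‖x - y‖) (hL0 : 0 ≤ L)
    {ζ : ℝ} (hζ : 0 ≤ ζ) {X Y Z : Var n d} (h : P.IsArgminH ρ ζ X Y Z) :
    ‖rgrad (P.F ρ) Z‖ ≤ (L + P.boundPi ζ) * ‖Z - Y‖ := by
  have hb := P.boundPi_nonneg hζ
  refine norm_rgrad_le_of_forall_inner_le (by positivity) fun U hU => ?_
  have h1 := h.inner_eq_zero hU
  have h2 := (neg_le_abs _).trans (P.abs_polarPi_le hρ hζ X (Z - Y) U)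
  have h3 := (real_inner_le_norm (gradient (P.F ρ) Z - gradient (P.F ρ) Y) U).trans
    (mul_le_mul_of_nonneg_right (hL Z Y) (norm_nonneg U))
  rw [inner_sub_left] at h3
  linarith

/-- Minimizing the surrogate at the current iterate decreases the objective. -/
lemma IsArgminH.F_le (hρ : IsLossKernel d (d + 1) ρ) (ζ : ℝ) {X Z : Var n d}
    (hX : X ∈ feasible n d) (h : P.IsArgminH ρ ζ X X Z) :
    P.F ρ Z ≤ P.F ρ X - ζ / 2 * ‖Z - X‖ ^ 2 := by
  have h1 := h.sum_le hX
  -- Taking `ξ = 0` in the majorant leaves all of `ζ` as surplus.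
  have h2 := P.F_le_majorant hρ 0 X Z
  have h3 := P.formGamma_add_le_formPi hρ 0 ζ X (Z - X)
  have h4 : P.formPi ρ ζ X (X - X) = 0 := by
    rw [sub_self, formPi_eq_polarPi, polarPi]; simp
  rw [h4, sub_self, inner_zero_right] at h1
  linarith

/-- Nothing is assumed on the surrogate value at `Z₀`. By the Lipschitz gradient it exceeds `F Z₀ -
F X` by at most a multiple of `‖Z₀ - X‖ ^ 2`. -/
lemma ImprovesG.F_le (hρ : IsLossKernel d (d + 1) ρ) {L : ℝ}
    (hL : ∀ x y, ‖gradient (P.F ρ) x - gradient (P.F ρ) y‖ ≤ L * ‖x - y‖) (hL0 : 0 ≤ L)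
    {ξ ζ : ℝ} (hζ : 0 ≤ ζ) (hξζ : ξ ≤ ζ) {X Z₀ Z : Var n d} (h : P.ImprovesG ρ ξ X X Z₀ Z) :
    P.F ρ Z + ξ / 2 * ‖Z - X‖ ^ 2 ≤ P.F ρ Z₀ + (L + P.boundPi ζ) * ‖Z₀ - X‖ ^ 2 := by
  have h1 := h.sum_le
  have h2 := P.F_le_majorant hρ ξ X Z
  have h3 := P.formGamma_add_le_formPi hρ ξ ζ X (Z₀ - X)
  have h4 := P.formPi_le hρ hζ X (Z₀ - X)
  have h5 := (abs_le.1 (abs_sub_sub_inner_gradient_le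
    (fun x => (P.hasGradientAt_F hρ x).differentiableAt) hL hL0 X Z₀)).1
  have h6 := mul_nonneg (sub_nonneg.2 hξζ) (sq_nonneg ‖Z₀ - X‖)
  have h7 := mul_nonneg (P.boundPi_nonneg hζ) (sq_nonneg ‖Z₀ - X‖)
  linarith

namespace IsIteration

variable {p : Params} {Xprev X : Var n d} {Fb : ℝ} {s : A → ℝ} {Xh₁ X₁ Xh X₂ Xnext : Var n d}
  {snext : A → ℝ}

lemma half_mem (h : P.IsIteration ρ p Xprev X Fb s Xh₁ X₁ Xh X₂ Xnext snext) :
    Xh ∈ feasible n d := by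
  by_cases hr : P.NeedsRestart ρ p.ψ Fb X Xh₁
  · exact (h.half_restart hr).1
  · rw [h.half_keep hr]; exact h.half_candidate.1

lemma next_mem (h : P.IsIteration ρ p Xprev X Fb s Xh₁ X₁ Xh X₂ Xnext snext) :
    Xnext ∈ feasible n d := by
  by_cases hf : Fb - P.F ρ X₂ < p.φ * (Fb - P.F ρ Xh)
  · rw [h.fallback hf]; exact h.half_mem
  · rw [h.accept hf]
    by_cases hr : P.NeedsRestart ρ p.ψ Fb X X₁
    · exact (h.full_restart hr).1
    · rw [h.full_keep hr]; exact h.full_candidate.1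

lemma one_le_snext (h : P.IsIteration ρ p Xprev X Fb s Xh₁ X₁ Xh X₂ Xnext snext) (α : A) :
    1 ≤ snext α := by
  rcases h.momentum α with h | ⟨-, h⟩ <;> rw [h] <;> exact one_le_nesterov _

/-- A kept candidate passed the test with `ψ`; a restarted one minimizes a majorant at `X`, with
surplus `ζ / 2`. -/
lemma half_decrease (h : P.IsIteration ρ p Xprev X Fb s Xh₁ X₁ Xh X₂ Xnext snext)
    (hρ : IsLossKernel d (d + 1) ρ) (hX : X ∈ feasible n d) (hF : P.F ρ X ≤ Fb) :
    min p.ψ (p.ζ / 2) * ‖Xh - X‖ ^ 2 ≤ Fb - P.F ρ Xh := by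
  by_cases hr : P.NeedsRestart ρ p.ψ Fb X Xh₁
  · have h1 := (h.half_restart hr).F_le hρ p.ζ hX
    have h2 := mul_le_mul_of_nonneg_right (min_le_right p.ψ (p.ζ / 2)) (sq_nonneg ‖Xh - X‖)
    linarith
  · rw [h.half_keep hr]
    have h1 := not_lt.1 hr
    have h2 := mul_le_mul_of_nonneg_right (min_le_left p.ψ (p.ζ / 2)) (sq_nonneg ‖Xh₁ - X‖)
    linarith

lemma half_le (h : P.IsIteration ρ p Xprev X Fb s Xh₁ X₁ Xh X₂ Xnext snext)
    (hρ : IsLossKernel d (d + 1) ρ) (hX : X ∈ feasible n d) (hF : P.F ρ X ≤ Fb) :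
    P.F ρ Xh ≤ Fb := by
  have h1 := h.half_decrease hρ hX hF
  have h2 : 0 ≤ min p.ψ (p.ζ / 2) :=
    le_min p.ψ_pos.le (by linarith [p.ξ_nonneg, p.ξ_le_ζ])
  have h3 : 0 ≤ min p.ψ (p.ζ / 2) * ‖Xh - X‖ ^ 2 := by positivity
  linarith

lemma next_decrease (h : P.IsIteration ρ p Xprev X Fb s Xh₁ X₁ Xh X₂ Xnext snext)
    (hρ : IsLossKernel d (d + 1) ρ) (hX : X ∈ feasible n d) (hF : P.F ρ X ≤ Fb) :
    p.φ * (Fb - P.F ρ Xh) ≤ Fb - P.F ρ Xnext := by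
  by_cases hf : Fb - P.F ρ X₂ < p.φ * (Fb - P.F ρ Xh)
  · rw [h.fallback hf]
    exact mul_le_of_le_one_left (sub_nonneg.2 (h.half_le hρ hX hF)) p.φ_le_one
  · rw [h.accept hf]
    exact not_lt.1 hf

lemma next_le (h : P.IsIteration ρ p Xprev X Fb s Xh₁ X₁ Xh X₂ Xnext snext)
    (hρ : IsLossKernel d (d + 1) ρ) (hX : X ∈ feasible n d) (hF : P.F ρ X ≤ Fb) :
    P.F ρ Xnext ≤ Fb := by
  have h1 := h.next_decrease hρ hX hF
  have h2 := mul_nonneg p.φ_pos.le (sub_nonneg.2 (h.half_le hρ hX hF))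
  linarith

lemma next_displacement (h : P.IsIteration ρ p Xprev X Fb s Xh₁ X₁ Xh X₂ Xnext snext)
    (hρ : IsLossKernel d (d + 1) ρ) (hX : X ∈ feasible n d) (hF : P.F ρ X ≤ Fb) {L : ℝ}
    (hL : ∀ x y, ‖gradient (P.F ρ) x - gradient (P.F ρ) y‖ ≤ L * ‖x - y‖) (hL0 : 0 ≤ L) :
    min p.ψ (p.ξ / 2) * ‖Xnext - X‖ ^ 2 ≤
      Fb - P.F ρ Xnext + (L + P.boundPi p.ζ) * ‖Xh - X‖ ^ 2 := by
  have hζ : 0 ≤ p.ζ := p.ξ_nonneg.trans p.ξ_le_ζ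
  have hb : 0 ≤ (L + P.boundPi p.ζ) * ‖Xh - X‖ ^ 2 := by
    have := P.boundPi_nonneg hζ
    positivity
  by_cases hf : Fb - P.F ρ X₂ < p.φ * (Fb - P.F ρ Xh)
  · rw [h.fallback hf]
    have h1 := h.half_decrease hρ hX hF
    have h2 : min p.ψ (p.ξ / 2) ≤ min p.ψ (p.ζ / 2) :=
      min_le_min le_rfl (by linarith [p.ξ_le_ζ])
    have h3 := mul_le_mul_of_nonneg_right h2 (sq_nonneg ‖Xh - X‖)
    linarith
  · rw [h.accept hf]
    by_cases hr : P.NeedsRestart ρ p.ψ Fb X X₁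
    · have h1 := (h.full_restart hr).F_le hρ hL hL0 hζ p.ξ_le_ζ
      have h2 := h.half_le hρ hX hF
      have h3 := mul_le_mul_of_nonneg_right (min_le_right p.ψ (p.ξ / 2)) (sq_nonneg ‖X₂ - X‖)
      linarith
    · rw [h.full_keep hr]
      have h1 := not_lt.1 hr
      have h2 := mul_le_mul_of_nonneg_right (min_le_left p.ψ (p.ξ / 2)) (sq_nonneg ‖X₁ - X‖)
      linarith

lemma norm_rgrad_half_le (h : P.IsIteration ρ p Xprev X Fb s Xh₁ X₁ Xh X₂ Xnext snext)
    (hρ : IsLossKernel d (d + 1) ρ) (hs : ∀ α, 1 ≤ s α) {L : ℝ}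
    (hL : ∀ x y, ‖gradient (P.F ρ) x - gradient (P.F ρ) y‖ ≤ L * ‖x - y‖) (hL0 : 0 ≤ L) :
    ‖rgrad (P.F ρ) Xh‖ ≤ (L + P.boundPi p.ζ) * (‖Xh - X‖ + ‖X - Xprev‖) := by
  have hζ : 0 ≤ p.ζ := p.ξ_nonneg.trans p.ξ_le_ζ
  have hb := P.boundPi_nonneg hζ
  by_cases hr : P.NeedsRestart ρ p.ψ Fb X Xh₁
  · refine ((h.half_restart hr).norm_rgrad_le hρ hL hL0 hζ).trans ?_
    gcongr
    exact le_add_of_nonneg_right (norm_nonneg _)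
  · rw [h.half_keep hr]
    refine (h.half_candidate.norm_rgrad_le hρ hL hL0 hζ).trans ?_
    gcongr
    refine (norm_sub_le_norm_sub_add_norm_sub _ X _).trans ?_
    gcongr
    rw [norm_sub_rev]
    exact norm_extrapolate_sub_le hs Xprev X

end IsIteration

end PoseGraph

/-! ### Real sequences -/

lemma tendsto_of_sq_le {u v : ℕ → ℝ} {c : ℝ} (hu : ∀ k, 0 ≤ u k) (h : ∀ k, u k ^ 2 ≤ c * v k)
    (hv : Tendsto v atTop (𝓝 0)) : Tendsto u atTop (𝓝 0) := by
  have h1 : Tendsto (fun k => u k ^ 2) atTop (𝓝 0) :=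
    squeeze_zero (fun k => sq_nonneg _) h (by simpa using hv.const_mul c)
  have h2 := h1.sqrt
  simpa [Real.sqrt_sq (hu _)] using h2

/-- The best of the first `K` terms decays like `1 / √K` when squares are dominated by two-step
decrements of a nonincreasing convergent sequence. -/
lemma exists_le_two_mul_sqrt {a b : ℕ → ℝ} {c l : ℝ} (hc : 0 < c) (hb : Antitone b)
    (hl : Tendsto b atTop (𝓝 l)) (h : ∀ k, a k ^ 2 ≤ c * (b (k - 1) - b (k + 1))) (K : ℕ)
    (hK : 1 ≤ K) : ∃ k < K, a k ≤ 2 * √(c * ((b 0 - l) / ((K : ℝ) + 1))) := by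
  -- Two interleaved telescoping sums. With `0 - 1 = 0` the bound is `0` at `K = 0`.
  have hsum (K : ℕ) : ∑ k ∈ Finset.range K, a k ^ 2 ≤ c * (2 * b 0 - b (K - 1) - b K) := by
    induction K with
    | zero => simp [two_mul]
    | succ K ih =>
      rw [Finset.sum_range_succ, Nat.add_sub_cancel]
      linarith [h K]
  have hlb (k : ℕ) : l ≤ b k := hb.le_of_tendsto hl k
  have hK' : (1 : ℝ) ≤ K := by exact_mod_cast hK
  have h0 : 0 ≤ b 0 - l := sub_nonneg.2 (hlb 0)
  obtain ⟨k, hk, hle⟩ := Finset.exists_le_of_sum_le (s := Finset.range K)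
    (f := fun k => a k ^ 2) (g := fun _ => 4 * (c * ((b 0 - l) / ((K : ℝ) + 1))))
    (Finset.nonempty_range_iff.2 (by omega)) (by
      rw [Finset.sum_const, Finset.card_range, nsmul_eq_mul]
      calc ∑ k ∈ Finset.range K, a k ^ 2 ≤ c * (2 * b 0 - b (K - 1) - b K) := hsum K
        _ ≤ c * (2 * (b 0 - l)) := by
          gcongr
          linarith [hlb (K - 1), hlb K]
        -- `2 ≤ 4 * K / (K + 1)` because `K ≥ 1`; this produces the `K + 1` and the factor `2 = √4`.
        _ ≤ (c * (b 0 - l)) * (4 * K / (K + 1)) := by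
          rw [show c * (2 * (b 0 - l)) = (c * (b 0 - l)) * 2 by ring]
          gcongr
          rw [le_div_iff₀ (by positivity)]
          linarith
        _ = _ := by ring)
  refine ⟨k, Finset.mem_range.1 hk, ?_⟩
  refine (Real.le_sqrt_of_sq_le hle).trans (le_of_eq ?_)
  rw [Real.sqrt_mul (by norm_num), show (4 : ℝ) = 2 ^ 2 by norm_num,
    Real.sqrt_sq (by norm_num)]

/-! ### Whole runs -/

namespace PoseGraph.IsRun

variable {A : Type*} {n : A → ℕ} {d : ℕ} {P : PoseGraph A n d} [Fintype A] [DecidableEq A]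
  {ρ : ℝ → ℝ} {p : Params} {X Xh : ℕ → Var n d}

lemma mem (h : P.IsRun ρ p X Xh) (k : ℕ) : X k ∈ feasible n d := by
  obtain ⟨h0, s, -, hs⟩ := h
  cases k with
  | zero => exact h0
  | succ k =>
    obtain ⟨_, _, _, hk⟩ := hs k
    exact hk.next_mem

lemma half_mem (h : P.IsRun ρ p X Xh) (k : ℕ) : Xh k ∈ feasible n d := by
  obtain ⟨h0, s, -, hs⟩ := h
  obtain ⟨_, _, _, hk⟩ := hs k
  exact hk.half_mem

/-- The invariant: `Fbar (k + 1)` is a convex combination of `Fbar k` and `F (X (k + 1))`, and the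
latter is the smaller one. -/
lemma F_le_Fbar (h : P.IsRun ρ p X Xh) (hρ : IsLossKernel d (d + 1) ρ) (k : ℕ) :
    P.F ρ (X k) ≤ P.Fbar ρ p.η X k := by
  induction k with
  | zero => rw [Fbar]; exact le_of_eq (by ring)
  | succ k ih =>
    have hm := h.mem k
    obtain ⟨-, s, -, hs⟩ := h
    obtain ⟨_, _, _, hk⟩ := hs k
    have h1 := mul_nonneg (sub_nonneg.2 p.η_le_one) (sub_nonneg.2 (hk.next_le hρ hm ih))
    rw [Fbar]
    linarith

lemma F_succ_le_Fbar (h : P.IsRun ρ p X Xh) (hρ : IsLossKernel d (d + 1) ρ) (k : ℕ) :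
    P.F ρ (X (k + 1)) ≤ P.Fbar ρ p.η X k := by
  have hm := h.mem k
  have hF := h.F_le_Fbar hρ k
  obtain ⟨-, s, -, hs⟩ := h
  obtain ⟨_, _, _, hk⟩ := hs k
  exact hk.next_le hρ hm hF

lemma F_half_le_Fbar (h : P.IsRun ρ p X Xh) (hρ : IsLossKernel d (d + 1) ρ) (k : ℕ) :
    P.F ρ (Xh k) ≤ P.Fbar ρ p.η X k := by
  have hm := h.mem k
  have hF := h.F_le_Fbar hρ k
  obtain ⟨-, s, -, hs⟩ := h
  obtain ⟨_, _, _, hk⟩ := hs k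
  exact hk.half_le hρ hm hF

lemma antitone_Fbar (h : P.IsRun ρ p X Xh) (hρ : IsLossKernel d (d + 1) ρ) :
    Antitone (P.Fbar ρ p.η X) := by
  refine antitone_nat_of_succ_le fun k => ?_
  have h1 := mul_nonneg p.η_pos.le (sub_nonneg.2 (h.F_succ_le_Fbar hρ k))
  rw [Fbar]
  linarith

lemma exists_tendsto (h : P.IsRun ρ p X Xh) (hρ : IsLossKernel d (d + 1) ρ) :
    ∃ l, Tendsto (fun k => P.F ρ (X k)) atTop (𝓝 l) ∧ Tendsto (P.Fbar ρ p.η X) atTop (𝓝 l) := by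
  have hb : Tendsto (P.Fbar ρ p.η X) atTop (𝓝 (⨅ k, P.Fbar ρ p.η X k)) :=
    tendsto_atTop_ciInf (h.antitone_Fbar hρ)
      ⟨0, by rintro _ ⟨k, rfl⟩; exact (P.F_nonneg hρ _).trans (h.F_le_Fbar hρ k)⟩
  refine ⟨_, ?_, hb⟩
  rw [← tendsto_add_atTop_iff_nat 1]
  have hη := p.η_pos.ne'
  -- The recursion of `Fbar` is solved for `F (X (k + 1))`, using `η > 0`.
  have h1 := (((tendsto_add_atTop_iff_nat 1).2 hb).sub (hb.const_mul (1 - p.η))).const_mul p.η⁻¹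
  have e : p.η⁻¹ * ((⨅ k, P.Fbar ρ p.η X k) - (1 - p.η) * ⨅ k, P.Fbar ρ p.η X k) =
      ⨅ k, P.Fbar ρ p.η X k := by
    field_simp; ring
  rw [e] at h1
  refine h1.congr fun k => ?_
  rw [Fbar]
  field_simp; ring

/-- Displacements are controlled by the decrease of the averaged objective values. -/
lemma exists_displacement_le (h : P.IsRun ρ p X Xh) (hρ : IsLossKernel d (d + 1) ρ)
    (hξ : 0 < p.ξ) : ∃ c : ℝ, 0 < c ∧ ∀ k,
      ‖Xh k - X k‖ ^ 2 ≤ c * (P.Fbar ρ p.η X k - P.Fbar ρ p.η X (k + 1)) ∧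
      ‖X (k + 1) - X k‖ ^ 2 ≤ c * (P.Fbar ρ p.η X k - P.Fbar ρ p.η X (k + 1)) := by
  obtain ⟨L, hL0, hL⟩ := P.exists_lipschitz_gradient_F hρ
  have hζ : 0 < p.ζ := hξ.trans_le p.ξ_le_ζ
  set δ := min p.ψ (p.ζ / 2)
  set μ := min p.ψ (p.ξ / 2)
  have hδ : 0 < δ := lt_min p.ψ_pos (by linarith)
  have hμ : 0 < μ := lt_min p.ψ_pos (by linarith)
  have hφ := p.φ_pos
  have hη := p.η_pos
  set C := L + P.boundPi p.ζ
  have hC : 0 ≤ C := add_nonneg hL0.le (P.boundPi_nonneg hζ.le)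
  -- With `Δ` the decrement of `Fbar`, the constants come from `φ δ ‖Xh k - X k‖² ≤ Δ / η` and `μ ‖X
  -- (k + 1) - X k‖² ≤ Δ / η + C c₁ Δ`.
  set c₁ := 1 / (p.φ * δ * p.η)
  set c₂ := (1 / p.η + C * c₁) / μ
  have hc₁ : 0 < c₁ := by positivity
  have hc₂ : 0 < c₂ := by positivity
  refine ⟨c₁ + c₂, by positivity, fun k => ?_⟩
  have hanti := sub_nonneg.2 (h.antitone_Fbar hρ k.le_succ)
  set Δ := P.Fbar ρ p.η X k - P.Fbar ρ p.η X (k + 1) with hΔ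
  have hstep : P.Fbar ρ p.η X k - P.F ρ (X (k + 1)) = Δ / p.η := by
    rw [hΔ, Fbar]; field_simp; ring
  have hm := h.mem k
  have hF := h.F_le_Fbar hρ k
  obtain ⟨-, s, -, hs⟩ := h
  obtain ⟨_, _, _, hk⟩ := hs k
  have h1 := mul_le_mul_of_nonneg_left (hk.half_decrease hρ hm hF) hφ.le
  have h2 := hk.next_decrease hρ hm hF
  have h3 := hk.next_displacement hρ hm hF hL hL0.le
  rw [hstep] at h2 h3
  have h4 : ‖Xh k - X k‖ ^ 2 ≤ c₁ * Δ := by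
    have : c₁ * Δ = Δ / p.η / (p.φ * δ) := by simp only [c₁]; field_simp
    rw [this, le_div_iff₀ (by positivity)]
    linarith
  have h5 : ‖X (k + 1) - X k‖ ^ 2 ≤ c₂ * Δ := by
    have : c₂ * Δ = (Δ / p.η + C * (c₁ * Δ)) / μ := by simp only [c₂]; ring
    rw [this, le_div_iff₀ hμ]
    linarith [mul_le_mul_of_nonneg_left h4 hC]
  have h6 := mul_nonneg hc₁.le hanti
  have h7 := mul_nonneg hc₂.le hanti
  constructor <;> linarith

lemma exists_norm_rgrad_half_le (h : P.IsRun ρ p X Xh) (hρ : IsLossKernel d (d + 1) ρ) :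
    ∃ C : ℝ, 0 < C ∧ ∀ k,
      ‖rgrad (P.F ρ) (Xh k)‖ ≤ C * (‖Xh k - X k‖ + ‖X k - X (k - 1)‖) := by
  obtain ⟨L, hL0, hL⟩ := P.exists_lipschitz_gradient_F hρ
  refine ⟨L + P.boundPi p.ζ,
    add_pos_of_pos_of_nonneg hL0 (P.boundPi_nonneg (p.ξ_nonneg.trans p.ξ_le_ζ)), fun k => ?_⟩
  obtain ⟨-, s, hs0, hs⟩ := h
  obtain ⟨_, _, _, hk⟩ := hs k
  refine hk.norm_rgrad_half_le hρ ?_ hL hL0.le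
  -- The bound `1 ≤ s k` is the initial value at `k = 0`; later it holds since `nesterov` is at
  -- least `1` everywhere, restart or not.
  cases k with
  | zero => exact fun α => (hs0 α).ge
  | succ k =>
    obtain ⟨_, _, _, hk⟩ := hs k
    exact hk.one_le_snext

lemma exists_norm_rgrad_half_sq_le (h : P.IsRun ρ p X Xh) (hρ : IsLossKernel d (d + 1) ρ)
    (hξ : 0 < p.ξ) : ∃ c : ℝ, 0 < c ∧ ∀ k, ‖rgrad (P.F ρ) (Xh k)‖ ^ 2 ≤
      c * (P.Fbar ρ p.η X (k - 1) - P.Fbar ρ p.η X (k + 1)) := by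
  obtain ⟨c, hc, hd⟩ := h.exists_displacement_le hρ hξ
  obtain ⟨C, hC, hg⟩ := h.exists_norm_rgrad_half_le hρ
  refine ⟨2 * C ^ 2 * c, by positivity, fun k => ?_⟩
  -- At `k = 0` both sides vanish, as `0 - 1 = 0`.
  have h1 : ‖X k - X (k - 1)‖ ^ 2 ≤ c * (P.Fbar ρ p.η X (k - 1) - P.Fbar ρ p.η X k) := by
    cases k with
    | zero => simp
    | succ k => exact (hd k).2
  calc ‖rgrad (P.F ρ) (Xh k)‖ ^ 2
      ≤ (C * (‖Xh k - X k‖ + ‖X k - X (k - 1)‖)) ^ 2 := by gcongr; exact hg k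
    _ = C ^ 2 * (‖Xh k - X k‖ + ‖X k - X (k - 1)‖) ^ 2 := by ring
    _ ≤ C ^ 2 * (2 * (‖Xh k - X k‖ ^ 2 + ‖X k - X (k - 1)‖ ^ 2)) := by
      gcongr; exact add_sq_le
    _ ≤ C ^ 2 * (2 * (c * (P.Fbar ρ p.η X k - P.Fbar ρ p.η X (k + 1)) +
          c * (P.Fbar ρ p.η X (k - 1) - P.Fbar ρ p.η X k))) := by
      gcongr; exact (hd k).1
    _ = _ := by ring

/-- Free translations rule out compactness as a source of a uniform constant. Instead `F (Xh k) ≤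
Fbar 0`, and `norm_gradient_sq_le` bounds the gradient on sublevel sets of `F`. -/
lemma exists_norm_rgrad_le (h : P.IsRun ρ p X Xh) (hρ : IsLossKernel d (d + 1) ρ) :
    ∃ C : ℝ, ∀ k, ‖rgrad (P.F ρ) (X k)‖ ≤ ‖rgrad (P.F ρ) (Xh k)‖ + C * ‖Xh k - X k‖ := by
  obtain ⟨L, hL0, hL⟩ := P.exists_lipschitz_gradient_F hρ
  have hbound (k : ℕ) : ‖gradient (P.F ρ) (Xh k)‖ ≤ √(4 * L * P.Fbar ρ p.η X 0) := by
    refine Real.le_sqrt_of_sq_le ((norm_gradient_sq_le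
      (fun x => (P.hasGradientAt_F hρ x).differentiableAt) hL hL0 (P.F_nonneg hρ) _).trans ?_)
    gcongr
    exact (h.F_half_le_Fbar hρ k).trans (h.antitone_Fbar hρ k.zero_le)
  refine ⟨L + 2 * √(4 * L * P.Fbar ρ p.η X 0) * transportConst n d, fun k => ?_⟩
  refine (norm_rgrad_le_add hL0.le hL (h.mem k) (h.half_mem k)).trans ?_
  have hc : 0 ≤ transportConst n d := by unfold transportConst; positivity
  gcongr
  exact hbound k

end PoseGraph.IsRun

end PGO

end

/-! ### The convergence theorem -/

theorem mainTheorem2 {A : Type*} [Fintype A] [DecidableEq A] {n : A → ℕ} {d : ℕ}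
    (P : PGO.PoseGraph A n d) (ρ : ℝ → ℝ) (hρ : PGO.IsLossKernel d (d + 1) ρ) (p : PGO.Params)
    (X Xh : ℕ → PGO.Var n d) (hrun : P.IsRun ρ p X Xh) :
    Antitone (P.Fbar ρ p.η X) ∧
    ∃ Finf : ℝ,
      (Tendsto (fun k => P.F ρ (X k)) atTop (𝓝 Finf) ∧
        Tendsto (P.Fbar ρ p.η X) atTop (𝓝 Finf)) ∧
      (0 < p.ξ → 0 < p.ζ → Tendsto (fun k => ‖X (k + 1) - X k‖) atTop (𝓝 0)) ∧
      (p.ξ ≤ p.ζ → 0 < p.ξ → Tendsto (fun k => ‖Xh k - X k‖) atTop (𝓝 0)) ∧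
      (p.ξ ≤ p.ζ → 0 < p.ξ → ∃ ε : ℝ, 0 < ε ∧ ∀ K : ℕ, 1 ≤ K → ∃ k < K,
        ‖PGO.rgrad (P.F ρ) (Xh k)‖ ≤
          2 * Real.sqrt (1 / ε * ((P.F ρ (X 0) - Finf) / ((K : ℝ) + 1)))) ∧
      (p.ξ < p.ζ → 0 < p.ξ →
        Tendsto (fun k => PGO.rgrad (P.F ρ) (X k)) atTop (𝓝 0) ∧
        Tendsto (fun k => PGO.rgrad (P.F ρ) (Xh k)) atTop (𝓝 0)) := by
  have hanti := hrun.antitone_Fbar hρ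
  obtain ⟨l, hF, hb⟩ := hrun.exists_tendsto hρ
  have hb1 : Tendsto (fun k => P.Fbar ρ p.η X (k + 1)) atTop (𝓝 l) :=
    (tendsto_add_atTop_iff_nat 1).2 hb
  have hdec : Tendsto (fun k => P.Fbar ρ p.η X k - P.Fbar ρ p.η X (k + 1)) atTop (𝓝 0) := by
    simpa using hb.sub hb1
  have hfull (hξ : 0 < p.ξ) : Tendsto (fun k => ‖X (k + 1) - X k‖) atTop (𝓝 0) := by
    obtain ⟨c, -, hd⟩ := hrun.exists_displacement_le hρ hξ
    exact PGO.tendsto_of_sq_le (fun _ => norm_nonneg _) (fun k => (hd k).2) hdec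
  have hhalf (hξ : 0 < p.ξ) : Tendsto (fun k => ‖Xh k - X k‖) atTop (𝓝 0) := by
    obtain ⟨c, -, hd⟩ := hrun.exists_displacement_le hρ hξ
    exact PGO.tendsto_of_sq_le (fun _ => norm_nonneg _) (fun k => (hd k).1) hdec
  refine ⟨hanti, l, ⟨hF, hb⟩, fun hξ _ => hfull hξ, fun _ hξ => hhalf hξ, fun _ hξ => ?_,
    fun _ hξ => ?_⟩
  · obtain ⟨c, hc, hg⟩ := hrun.exists_norm_rgrad_half_sq_le hρ hξ
    refine ⟨1 / c, by positivity, fun K hK => ?_⟩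
    have h0 : P.Fbar ρ p.η X 0 = P.F ρ (X 0) := by rw [PGO.PoseGraph.Fbar]; ring
    rw [one_div_one_div, ← h0]
    exact PGO.exists_le_two_mul_sqrt hc hanti hb hg K hK
  · obtain ⟨c, -, hg⟩ := hrun.exists_norm_rgrad_half_sq_le hρ hξ
    obtain ⟨C, hC⟩ := hrun.exists_norm_rgrad_le hρ
    have hdec2 : Tendsto (fun k => P.Fbar ρ p.η X (k - 1) - P.Fbar ρ p.η X (k + 1)) atTop
        (𝓝 0) := by
      simpa using (hb.comp (tendsto_sub_atTop_nat 1)).sub hb1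
    have h1 : Tendsto (fun k => ‖PGO.rgrad (P.F ρ) (Xh k)‖) atTop (𝓝 0) :=
      PGO.tendsto_of_sq_le (fun _ => norm_nonneg _) hg hdec2
    refine ⟨tendsto_zero_iff_norm_tendsto_zero.2 ?_, tendsto_zero_iff_norm_tendsto_zero.2 h1⟩
    refine squeeze_zero (fun _ => norm_nonneg _) hC ?_
    simpa using h1.add ((hhalf hξ).const_mul C)
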